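/- Let $\Bbbk$ be an algebraically closed field of characteristic zero, let $n\ge 3$ be odd, and let $q\in\Bbbk$ be a primitive $n$th root of unity. Let $\mathsf D_n$ be the Drinfeld double of the Taft algebra: the $\Bbbk$-algebra with generators $a,b,c,d$ and relations $$ba=qab,\quad db=qbd,\quad bc=cb,\quad ca=qac,\quad dc=qcd,\quad da-qad=1-bc,\quad a^n=d^n=0,\quad b^n=c^n=1,$$ with coproduct $\Delta(a)=a\otimes b+1\otimes a$, $\Delta(d)=d\otimes c+1\otimes d$, $\Delta(b)=b\otimes b$, $\Delta(c)=c\otimes c$, and R-matrix $$\mathcal R=\frac1n\sum_{m,s,t=0}^{n-1}\frac{q^{-tm}}{[s]!}\,a^sb^t\otimes c^md^s,\qquad [s]!=\prod_{j=1}^s(1+q+\dots+q^{j-1}).$$ For $1\le \ell\le n$ and $s\in\mathbb Z/n\mathbb Z$ let $\mathsf V(\ell,s)$ be the simple $\mathsf D_n$-module with basis $v_1,\dots,v_\ell$ and action $a v_j=v_{j+1}$ for $j<\ell$, $a v_\ell=0$, $b v_j=q^{s+j-1}v_j$, $c v_j=q^{j-(s+\ell)}v_j$, $d v_1=0$, and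 $d v_j=\frac{(q^{j-1}-1)(1-q^{j-1-\ell})}{q-1}v_{j-1}$ for $j>1$. For a $\mathsf D_n$-module $\mathsf V$, let $\check{\mathsf R}=\sigma\circ\mathcal R$ on $\mathsf V\otimes\mathsf V$, where $\sigma$ interchanges the two factors, and for $1\le i\le k-1$ let $\check{\mathsf R}_i$ be the operator on $\mathsf V^{\otimes k}$ that acts as $\check{\mathsf R}$ on the tensor slots $i,i+1$ and as the identity on the others. **Proposition.** Let $\ell\ge1$ with $2\ell\le n+1$, let $r\in\mathbb Z/n\mathbb Z$, and let $\mathsf V=\mathsf V(\ell,r)$. For $k\ge 2$ and $1\le i\le k-1$, the operator $\check{\mathsf R}_i$ on $\mathsf V^{\otimes k}$ satisfies $$\prod_{\mathsf U}\bigl(\check{\mathsf R}_i^2-c_{\mathsf U}\,\mathrm{id}\bigr)=0,$$ where the product is over the isomorphism classes of simple $\mathsf D_n$-modules $\mathsf U=\mathsf V(a,b)$ ($1\le a\le n$, $b\in\mathbb Z/n\mathbb Z$) occurring as direct summands of the $\mathsf D_n$-module $\mathsf V^{\otimes 2}$, and $$c_{\mathsf U}=q^{\,2r^2+(2r-1)(\ell-1)-b(a+b-1)-\frac12(n-1)(a-1)}\qquad\text{for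 }\mathsf U=\mathsf V(a,b).$$ Moreover, every eigenvalue of $\check{\mathsf R}_i$ on $\mathsf V^{\otimes k}$ is one of the values $\pm\sqrt{c_{\mathsf U}}$, with $\mathsf U$ among these summands. -/

import Mathlib

open scoped TensorProduct

namespace TaftDouble

section QuantumIntegers

variable {k : Type*} [Field k]

/-- The quantum integer `[m] = 1 + q + ⋯ + q^(m-1)`. -/
def qInt (q : k) (m : ℕ) : k := ∑ i ∈ Finset.range m, q ^ i

/-- The quantum factorial `[m]! = [m][m-1]⋯[1]`, with `[0]! = 1`. -/
def qFact (q : k) (m : ℕ) : k := ∏ i ∈ Finset.range m, qInt q (i + 1)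

lemma qInt_add (q : k) (i j : ℕ) : qInt q (i + j) = qInt q i + q ^ i * qInt q j := by
  simp [qInt, Finset.sum_range_add, Finset.mul_sum, pow_add]

lemma qInt_ne_zero {q : k} {n : ℕ} (hq : IsPrimitiveRoot q n) {m : ℕ} (h0 : 0 < m) (hm : m < n) :
    qInt q m ≠ 0 := by
  intro h
  have h1 : (q - 1) * qInt q m = q ^ m - 1 := by
    rw [mul_comm]; exact geom_sum_mul q m
  rw [h, mul_zero] at h1
  exact hq.pow_ne_one_of_pos_of_lt h0.ne' hm (sub_eq_zero.mp h1.symm)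

lemma qFact_ne_zero {q : k} {n : ℕ} (hq : IsPrimitiveRoot q n) {m : ℕ} (hm : m < n) :
    qFact q m ≠ 0 := by
  refine Finset.prod_ne_zero_iff.mpr fun i hi => qInt_ne_zero hq (Nat.succ_pos i) ?_
  have := Finset.mem_range.mp hi
  omega

lemma qFact_succ (q : k) (m : ℕ) : qFact q (m + 1) = qFact q m * qInt q (m + 1) :=
  Finset.prod_range_succ _ _

/-- Auxiliary: the Gaussian binomial coefficients, by their recursion. -/
def qBinom (q : k) : ℕ → ℕ → k
  | _, 0 => 1
  | 0, _ + 1 => 0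
  | m + 1, j + 1 => qBinom q m j + q ^ (j + 1) * qBinom q m (j + 1)

lemma qBinom_of_lt (q : k) : ∀ m j : ℕ, m < j → qBinom q m j = 0
  | _, 0, h => absurd h (by omega)
  | 0, _ + 1, _ => by simp [qBinom]
  | m + 1, j + 1, h => by
    rw [qBinom, qBinom_of_lt q m j (by omega), qBinom_of_lt q m (j + 1) (by omega)]
    simp

lemma qBinom_mul_qFact (q : k) : ∀ i j : ℕ,
    qBinom q (i + j) j * (qFact q i * qFact q j) = qFact q (i + j)
  | i, 0 => by cases i <;> simp [qBinom, qFact]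
  | 0, j + 1 => by
    have h := qBinom_mul_qFact q 0 j
    simp only [Nat.zero_add] at h ⊢
    rw [qBinom, qBinom_of_lt q j (j + 1) (by omega), qFact_succ]
    linear_combination qInt q (j + 1) * h
  | i + 1, j + 1 => by
    have h1 := qBinom_mul_qFact q (i + 1) j
    have h2 := qBinom_mul_qFact q i (j + 1)
    have e1 : i + 1 + j = i + (j + 1) := by omega
    have e2 : i + 1 + (j + 1) = (i + (j + 1)) + 1 := by omega
    have e3 : i + (j + 1) + 1 = (j + 1) + (i + 1) := by omega
    rw [e1] at h1
    rw [e2, qBinom, qFact_succ q (i + (j + 1)), e3, qInt_add q (j + 1) (i + 1)]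
    rw [qFact_succ q i] at h1 ⊢
    rw [qFact_succ q j] at h2 ⊢
    linear_combination qInt q (j + 1) * h1 + q ^ (j + 1) * qInt q (i + 1) * h2

lemma qBinom_eq_zero {q : k} {n : ℕ} (hq : IsPrimitiveRoot q n) {j : ℕ} (h0 : 0 < j) (hj : j < n) :
    qBinom q n j = 0 := by
  have h := qBinom_mul_qFact q (n - j) j
  rw [Nat.sub_add_cancel hj.le] at h
  have hn : qFact q n = 0 := by
    obtain ⟨m, rfl⟩ : ∃ m, n = m + 1 := ⟨n - 1, by omega⟩
    rw [qFact_succ]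
    have h1 : (q - 1) * qInt q (m + 1) = 0 := by
      rw [mul_comm]
      exact (geom_sum_mul q (m + 1)).trans (by rw [hq.pow_eq_one, sub_self])
    have h2 : q - 1 ≠ 0 := sub_ne_zero.mpr (hq.ne_one (by omega))
    rw [(mul_eq_zero.mp h1).resolve_left h2, mul_zero]
  rw [hn] at h
  exact (mul_eq_zero.mp h).resolve_right
    (mul_ne_zero (qFact_ne_zero hq (by omega)) (qFact_ne_zero hq hj))

lemma mul_pow_of_qcomm {A : Type*} [Ring A] [Algebra k A] {q : k} {x y : A}
    (h : y * x = q • (x * y)) (j : ℕ) : y * x ^ j = q ^ j • (x ^ j * y) := by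
  induction j with
  | zero => simp
  | succ j ih =>
    rw [pow_succ, ← mul_assoc, ih, smul_mul_assoc, mul_assoc, h, mul_smul_comm, smul_smul,
      ← pow_succ, mul_assoc]

/-- The quantum binomial theorem. -/
lemma add_pow_of_qcomm {A : Type*} [Ring A] [Algebra k A] {q : k} {x y : A}
    (h : y * x = q • (x * y)) (m : ℕ) :
    (x + y) ^ m = ∑ j ∈ Finset.range (m + 1), qBinom q m j • (x ^ j * y ^ (m - j)) := by
  induction m with
  | zero => simp [qBinom]
  | succ m ih =>
    rw [pow_succ', ih, add_mul, Finset.mul_sum, Finset.mul_sum,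
      Finset.sum_range_succ' _ (m + 1)]
    have hx : ∀ j ∈ Finset.range (m + 1), x * qBinom q m j • (x ^ j * y ^ (m - j))
        = qBinom q m j • (x ^ (j + 1) * y ^ (m + 1 - (j + 1))) := by
      intro j _
      rw [mul_smul_comm, ← mul_assoc, ← pow_succ', Nat.add_sub_add_right]
    have hy : ∀ j ∈ Finset.range (m + 1), y * qBinom q m j • (x ^ j * y ^ (m - j))
        = (q ^ j * qBinom q m j) • (x ^ j * y ^ (m + 1 - j)) := by
      intro j hj
      have := Finset.mem_range.mp hj
      rw [mul_smul_comm, ← mul_assoc, mul_pow_of_qcomm h, smul_mul_assoc, mul_assoc, ← pow_succ',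
        smul_smul, mul_comm (q ^ j), show m - j + 1 = m + 1 - j by omega]
    rw [Finset.sum_congr rfl hx, Finset.sum_congr rfl hy]
    simp only [qBinom, add_smul, Finset.sum_add_distrib]
    rw [add_assoc]
    congr 1
    rw [Finset.sum_range_succ' _ m, Finset.sum_range_succ _ m, qBinom_of_lt q m (m + 1) (by omega)]
    cases m <;> simp [qBinom]

lemma add_pow_eq_of_qcomm {A : Type*} [Ring A] [Algebra k A] {q : k} {n : ℕ} [NeZero n]
    (hq : IsPrimitiveRoot q n) {x y : A} (h : y * x = q • (x * y))
    (hx : x ^ n = 0) (hy : y ^ n = 0) : (x + y) ^ n = 0 := by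
  rw [add_pow_of_qcomm h]
  refine Finset.sum_eq_zero fun j hj => ?_
  rcases Nat.eq_zero_or_pos j with rfl | h0
  · simp [hy]
  rcases Nat.lt_or_ge j n with h1 | h1
  · rw [qBinom_eq_zero hq h0 h1, zero_smul]
  · have : j = n := by have := Finset.mem_range.mp hj; omega
    rw [this, hx, zero_mul, smul_zero]

end QuantumIntegers

/-- The four generators. -/
inductive Gen
  | a | b | c | d

section Algebra

variable {k : Type*} [Field k]

/-- The generators as elements of the free algebra. -/
abbrev gen (k : Type*) [Field k] (g : Gen) : FreeAlgebra k Gen := FreeAlgebra.ι k g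

/-- The defining relations of the Drinfeld double `D_n` of the Taft algebra. -/
inductive Rel (n : ℕ) (q : k) : FreeAlgebra k Gen → FreeAlgebra k Gen → Prop
  | ba : Rel n q (gen k .b * gen k .a) (q • (gen k .a * gen k .b))
  | db : Rel n q (gen k .d * gen k .b) (q • (gen k .b * gen k .d))
  | bc : Rel n q (gen k .b * gen k .c) (gen k .c * gen k .b)
  | ca : Rel n q (gen k .c * gen k .a) (q • (gen k .a * gen k .c))
  | dc : Rel n q (gen k .d * gen k .c) (q • (gen k .c * gen k .d))
  | da : Rel n q (gen k .d * gen k .a - q • (gen k .a * gen k .d)) (1 - gen k .b * gen k .c)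
  | a_pow : Rel n q (gen k .a ^ n) 0
  | d_pow : Rel n q (gen k .d ^ n) 0
  | b_pow : Rel n q (gen k .b ^ n) 1
  | c_pow : Rel n q (gen k .c ^ n) 1

/-- The Drinfeld double `D_n` of the Taft algebra, by generators and relations. -/
abbrev D (n : ℕ) (q : k) : Type _ := RingQuot (Rel n q)

/-- The generators of `D_n`. -/
def D.of (n : ℕ) (q : k) (g : Gen) : D n q := RingQuot.mkAlgHom k (Rel n q) (gen k g)

/-- The relations, for four elements of an arbitrary `k`-algebra. -/
structure Satisfies {A : Type*} [Ring A] [Algebra k A] (n : ℕ) (q : k) (f : Gen → A) : Prop where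
  ba : f .b * f .a = q • (f .a * f .b)
  db : f .d * f .b = q • (f .b * f .d)
  bc : f .b * f .c = f .c * f .b
  ca : f .c * f .a = q • (f .a * f .c)
  dc : f .d * f .c = q • (f .c * f .d)
  da : f .d * f .a - q • (f .a * f .d) = 1 - f .b * f .c
  a_pow : f .a ^ n = 0
  d_pow : f .d ^ n = 0
  b_pow : f .b ^ n = 1
  c_pow : f .c ^ n = 1

lemma D.satisfies (n : ℕ) (q : k) : Satisfies n q (D.of n q) where
  ba := by simpa [D.of] using RingQuot.mkAlgHom_rel k (Rel.ba (n := n) (q := q))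
  db := by simpa [D.of] using RingQuot.mkAlgHom_rel k (Rel.db (n := n) (q := q))
  bc := by simpa [D.of] using RingQuot.mkAlgHom_rel k (Rel.bc (n := n) (q := q))
  ca := by simpa [D.of] using RingQuot.mkAlgHom_rel k (Rel.ca (n := n) (q := q))
  dc := by simpa [D.of] using RingQuot.mkAlgHom_rel k (Rel.dc (n := n) (q := q))
  da := by simpa [D.of] using RingQuot.mkAlgHom_rel k (Rel.da (n := n) (q := q))
  a_pow := by simpa [D.of] using RingQuot.mkAlgHom_rel k (Rel.a_pow (n := n) (q := q))
  d_pow := by simpa [D.of] using RingQuot.mkAlgHom_rel k (Rel.d_pow (n := n) (q := q))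
  b_pow := by simpa [D.of] using RingQuot.mkAlgHom_rel k (Rel.b_pow (n := n) (q := q))
  c_pow := by simpa [D.of] using RingQuot.mkAlgHom_rel k (Rel.c_pow (n := n) (q := q))

/-- The universal property of `D_n`. -/
def D.lift {A : Type*} [Ring A] [Algebra k A] {n : ℕ} {q : k} (f : Gen → A)
    (hf : Satisfies n q f) : D n q →ₐ[k] A :=
  RingQuot.liftAlgHom k ⟨FreeAlgebra.lift k f, by
    rintro x y (_ | _)
    · simpa using hf.ba
    · simpa using hf.db
    · simpa using hf.bc
    · simpa using hf.ca
    · simpa using hf.dc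
    · simpa using hf.da
    · simpa using hf.a_pow
    · simpa using hf.d_pow
    · simpa using hf.b_pow
    · simpa using hf.c_pow⟩

@[simp] lemma D.lift_of {A : Type*} [Ring A] [Algebra k A] {n : ℕ} {q : k} (f : Gen → A)
    (hf : Satisfies n q f) (g : Gen) : D.lift f hf (D.of n q g) = f g := by
  simp [D.lift, D.of]

/-- The coproduct on generators: `Δ(a) = a ⊗ b + 1 ⊗ a`, `Δ(d) = d ⊗ c + 1 ⊗ d`,
`Δ(b) = b ⊗ b`, `Δ(c) = c ⊗ c`. -/
def comulGen (n : ℕ) (q : k) : Gen → D n q ⊗[k] D n q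
  | .a => D.of n q .a ⊗ₜ D.of n q .b + 1 ⊗ₜ D.of n q .a
  | .b => D.of n q .b ⊗ₜ D.of n q .b
  | .c => D.of n q .c ⊗ₜ D.of n q .c
  | .d => D.of n q .d ⊗ₜ D.of n q .c + 1 ⊗ₜ D.of n q .d

lemma comulGen_satisfies {n : ℕ} [NeZero n] {q : k} (hq : IsPrimitiveRoot q n) :
    Satisfies n q (comulGen n q) := by
  have h := D.satisfies n q
  constructor
  · simp [comulGen, mul_add, add_mul, h.ba, TensorProduct.smul_tmul', smul_add]
  · simp [comulGen, mul_add, add_mul, h.db, h.bc, TensorProduct.smul_tmul', smul_add]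
  · simp [comulGen, h.bc]
  · simp [comulGen, mul_add, add_mul, h.ca, h.bc, TensorProduct.smul_tmul', smul_add]
  · simp [comulGen, mul_add, add_mul, h.dc, TensorProduct.smul_tmul', smul_add]
  · have hda : D.of n q .d * D.of n q .a
        = 1 - D.of n q .b * D.of n q .c + q • (D.of n q .a * D.of n q .d) := by
      rw [← h.da]; abel
    simp only [comulGen, mul_add, add_mul, Algebra.TensorProduct.tmul_mul_tmul, one_mul, mul_one,
      hda, h.ca, h.db, ← h.bc, TensorProduct.tmul_add, TensorProduct.add_tmul,
      TensorProduct.tmul_sub, TensorProduct.sub_tmul, TensorProduct.tmul_smul,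
      TensorProduct.smul_tmul', smul_add, Algebra.TensorProduct.one_def]
    abel
  · rw [comulGen, add_comm]
    refine add_pow_eq_of_qcomm (A := D n q ⊗[k] D n q) (x := 1 ⊗ₜ[k] D.of n q .a)
      (y := D.of n q .a ⊗ₜ[k] D.of n q .b) hq ?_ ?_ ?_
    · simp [h.ba]
    · simp [h.a_pow]
    · simp [h.a_pow]
  · refine add_pow_eq_of_qcomm (A := D n q ⊗[k] D n q) (x := D.of n q .d ⊗ₜ[k] D.of n q .c)
      (y := 1 ⊗ₜ[k] D.of n q .d) hq ?_ ?_ ?_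
    · simp [h.dc]
    · simp [h.d_pow]
    · simp [h.d_pow]
  · simp [comulGen, h.b_pow, Algebra.TensorProduct.one_def]
  · simp [comulGen, h.c_pow, Algebra.TensorProduct.one_def]

/-- The coproduct of `D_n`. -/
def comul {n : ℕ} [NeZero n] {q : k} (hq : IsPrimitiveRoot q n) : D n q →ₐ[k] D n q ⊗[k] D n q :=
  D.lift (comulGen n q) (comulGen_satisfies hq)

/-- The R-matrix
`𝓡 = (1/n) ∑_{m,s,t=0}^{n-1} (q^(-tm) / [s]!) a^s b^t ⊗ c^m d^s` of `D_n`. -/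
noncomputable def rMatrix (n : ℕ) (q : k) : D n q ⊗[k] D n q :=
  (1 / (n : k)) • ∑ m ∈ Finset.range n, ∑ s ∈ Finset.range n, ∑ t ∈ Finset.range n,
    (q ^ (-((t : ℤ) * (m : ℤ))) / qFact q s) •
      ((D.of n q .a ^ s * D.of n q .b ^ t) ⊗ₜ[k] (D.of n q .c ^ m * D.of n q .d ^ s))

end Algebra

section Modules

variable {k : Type*} [Field k]

/-- `α_i(ℓ) = (q^i - 1)(1 - q^(i-ℓ)) / (q - 1)`. -/
noncomputable def alpha (q : k) (i ℓ : ℕ) : k :=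
  (q ^ i - 1) * (1 - q ^ ((i : ℤ) - (ℓ : ℤ))) / (q - 1)

/-- The operators by which the generators act on `V(ℓ,s)`. The basis vector `v_j`, `1 ≤ j ≤ ℓ`, is
the standard basis vector with index `j - 1`, so that, with `j : Fin ℓ`,
`a e_j = e_{j+1}`, `b e_j = q^(s+j) e_j`, `c e_j = q^(j+1-(s+ℓ)) e_j`, `d e_j = α_j(ℓ) e_{j-1}`. -/
noncomputable def simpleGen {n : ℕ} (q : k) (ℓ : ℕ) (s : ZMod n) :
    Gen → Module.End k (Fin ℓ → k)
  | .a => (Pi.basisFun k (Fin ℓ)).constr k fun j =>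
      if h : (j : ℕ) + 1 < ℓ then Pi.basisFun k (Fin ℓ) ⟨j + 1, h⟩ else 0
  | .b => (Pi.basisFun k (Fin ℓ)).constr k fun j =>
      q ^ ((s.val : ℤ) + (j : ℕ)) • Pi.basisFun k (Fin ℓ) j
  | .c => (Pi.basisFun k (Fin ℓ)).constr k fun j =>
      q ^ (((j : ℕ) : ℤ) + 1 - ((s.val : ℤ) + (ℓ : ℤ))) • Pi.basisFun k (Fin ℓ) j
  | .d => (Pi.basisFun k (Fin ℓ)).constr k fun j =>
      if 0 < (j : ℕ) then
        alpha q j ℓ • Pi.basisFun k (Fin ℓ) ⟨j - 1, lt_of_le_of_lt (Nat.sub_le _ _) j.isLt⟩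
      else 0

section Basis

variable {n : ℕ} (q : k) (ℓ : ℕ) (s : ZMod n) (j : Fin ℓ)

lemma simpleGen_a : simpleGen q ℓ s .a (Pi.basisFun k (Fin ℓ) j) =
    if h : (j : ℕ) + 1 < ℓ then Pi.basisFun k (Fin ℓ) ⟨j + 1, h⟩ else 0 :=
  Module.Basis.constr_basis _ _ _ _

lemma simpleGen_b : simpleGen q ℓ s .b (Pi.basisFun k (Fin ℓ) j) =
    q ^ ((s.val : ℤ) + (j : ℕ)) • Pi.basisFun k (Fin ℓ) j :=
  Module.Basis.constr_basis _ _ _ _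

lemma simpleGen_c : simpleGen q ℓ s .c (Pi.basisFun k (Fin ℓ) j) =
    q ^ (((j : ℕ) : ℤ) + 1 - ((s.val : ℤ) + (ℓ : ℤ))) • Pi.basisFun k (Fin ℓ) j :=
  Module.Basis.constr_basis _ _ _ _

lemma simpleGen_d : simpleGen q ℓ s .d (Pi.basisFun k (Fin ℓ) j) =
    if 0 < (j : ℕ) then
      alpha q j ℓ • Pi.basisFun k (Fin ℓ) ⟨j - 1, lt_of_le_of_lt (Nat.sub_le _ _) j.isLt⟩
    else 0 :=
  Module.Basis.constr_basis _ _ _ _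

lemma simpleGen_a_pow (m : ℕ) : (simpleGen q ℓ s .a ^ m) (Pi.basisFun k (Fin ℓ) j) =
    if h : (j : ℕ) + m < ℓ then Pi.basisFun k (Fin ℓ) ⟨j + m, h⟩ else 0 := by
  induction m with
  | zero => simp
  | succ m ih =>
    rw [pow_succ', Module.End.mul_apply, ih]
    split_ifs with h1 h2 h2
    · rw [simpleGen_a, dif_pos (show (j : ℕ) + m + 1 < ℓ by omega)]
      rfl
    · rw [simpleGen_a, dif_neg (show ¬ (j : ℕ) + m + 1 < ℓ by omega)]
    · omega
    · exact map_zero _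

lemma simpleGen_d_pow (m : ℕ) (hm : (j : ℕ) < m) :
    (simpleGen q ℓ s .d ^ m) (Pi.basisFun k (Fin ℓ) j) = 0 := by
  induction m generalizing j with
  | zero => omega
  | succ m ih =>
    rw [pow_succ, Module.End.mul_apply, simpleGen_d]
    split_ifs with h1
    · rw [map_smul, ih _ (by simp only; omega), smul_zero]
    · exact map_zero _

lemma simpleGen_b_pow (m : ℕ) : (simpleGen q ℓ s .b ^ m) (Pi.basisFun k (Fin ℓ) j) =
    (q ^ ((s.val : ℤ) + (j : ℕ))) ^ m • Pi.basisFun k (Fin ℓ) j := by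
  induction m with
  | zero => simp
  | succ m ih =>
    rw [pow_succ, Module.End.mul_apply, simpleGen_b, map_smul, ih, smul_smul, ← pow_succ']

lemma simpleGen_c_pow (m : ℕ) : (simpleGen q ℓ s .c ^ m) (Pi.basisFun k (Fin ℓ) j) =
    (q ^ (((j : ℕ) : ℤ) + 1 - ((s.val : ℤ) + (ℓ : ℤ)))) ^ m • Pi.basisFun k (Fin ℓ) j := by
  induction m with
  | zero => simp
  | succ m ih =>
    rw [pow_succ, Module.End.mul_apply, simpleGen_c, map_smul, ih, smul_smul, ← pow_succ']

end Basis

lemma zpow_pow_eq_one {n : ℕ} {q : k} (hq : IsPrimitiveRoot q n) (x : ℤ) : (q ^ x) ^ n = 1 := by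
  rw [← zpow_natCast, ← zpow_mul, mul_comm, zpow_mul, zpow_natCast, hq.pow_eq_one, one_zpow]

lemma alpha_zero (q : k) (ℓ : ℕ) : alpha q 0 ℓ = 0 := by simp [alpha]

lemma alpha_self (q : k) (ℓ : ℕ) : alpha q ℓ ℓ = 0 := by simp [alpha]

lemma alpha_succ {q : k} (h0 : q ≠ 0) (h1 : q ≠ 1) (j ℓ : ℕ) :
    alpha q (j + 1) ℓ - q * alpha q j ℓ = 1 - q ^ (2 * (j : ℤ) + 1 - ℓ) := by
  have h2 : q - 1 ≠ 0 := sub_ne_zero.mpr h1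
  have e1 : q ^ ((j : ℤ) + 1 - ℓ) = q * q ^ j * (q ^ ℓ)⁻¹ := by
    rw [zpow_sub₀ h0, zpow_add₀ h0]; simp [div_eq_mul_inv, mul_comm]
  have e2 : q ^ ((j : ℤ) - ℓ) = q ^ j * (q ^ ℓ)⁻¹ := by
    rw [zpow_sub₀ h0]; simp [div_eq_mul_inv]
  have e3 : q ^ (2 * (j : ℤ) + 1 - ℓ) = q * q ^ j * q ^ j * (q ^ ℓ)⁻¹ := by
    rw [zpow_sub₀ h0, zpow_add₀ h0, two_mul, zpow_add₀ h0]
    simp only [zpow_natCast, zpow_one, div_eq_mul_inv]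
    ring
  simp only [alpha, Nat.cast_add, Nat.cast_one, e1, e2, e3]
  field_simp
  ring

lemma simpleGen_satisfies {n : ℕ} {q : k} (hn : 2 ≤ n) (hq : IsPrimitiveRoot q n) {ℓ : ℕ}
    (hℓ : ℓ ≤ n) (s : ZMod n) : Satisfies n q (simpleGen q ℓ s) := by
  have h0 : q ≠ 0 := hq.ne_zero (by omega)
  have h1 : q ≠ 1 := hq.ne_one (by omega)
  constructor <;> refine (Pi.basisFun k (Fin ℓ)).ext fun j => ?_
  · simp only [Module.End.mul_apply, LinearMap.smul_apply, simpleGen_b, simpleGen_a, map_smul]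
    split_ifs with h
    · rw [simpleGen_b, smul_smul]
      congr 1
      simp only [Nat.cast_add, Nat.cast_one]
      rw [← add_assoc, zpow_add₀ h0 _ 1, zpow_one, mul_comm]
    · simp
  · simp only [Module.End.mul_apply, LinearMap.smul_apply, simpleGen_b, simpleGen_d, map_smul]
    split_ifs with h
    · rw [map_smul, simpleGen_b, smul_smul, smul_smul, smul_smul]
      congr 1
      simp only [Nat.cast_pred h]
      rw [← add_sub_assoc, zpow_sub₀ h0 _ 1, zpow_one]
      field_simp
    · simp
  · simp only [Module.End.mul_apply, simpleGen_b, simpleGen_c, map_smul, smul_smul]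
    rw [mul_comm]
  · simp only [Module.End.mul_apply, LinearMap.smul_apply, simpleGen_c, simpleGen_a, map_smul]
    split_ifs with h
    · rw [simpleGen_c, smul_smul]
      congr 1
      simp only [Nat.cast_add, Nat.cast_one]
      rw [← zpow_one_add₀ h0]
      congr 1
      ring
    · simp
  · simp only [Module.End.mul_apply, LinearMap.smul_apply, simpleGen_c, simpleGen_d, map_smul]
    split_ifs with h
    · rw [map_smul, simpleGen_c, smul_smul, smul_smul, smul_smul]
      congr 1
      simp only [Nat.cast_pred h]
      rw [mul_right_comm, ← zpow_one_add₀ h0]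
      congr 2
      ring
    · simp
  · have key := alpha_succ h0 h1 (j : ℕ) ℓ
    have hbc : (simpleGen q ℓ s .b * simpleGen q ℓ s .c) (Pi.basisFun k (Fin ℓ) j)
        = q ^ (2 * ((j : ℕ) : ℤ) + 1 - ℓ) • Pi.basisFun k (Fin ℓ) j := by
      rw [Module.End.mul_apply, simpleGen_c, map_smul, simpleGen_b, smul_smul, ← zpow_add₀ h0]
      congr 2
      ring
    have hda : (simpleGen q ℓ s .d * simpleGen q ℓ s .a) (Pi.basisFun k (Fin ℓ) j)
        = alpha q (j + 1) ℓ • Pi.basisFun k (Fin ℓ) j := by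
      rw [Module.End.mul_apply, simpleGen_a]
      split_ifs with h
      · rw [simpleGen_d, if_pos (Nat.succ_pos _)]
        rfl
      · have hj : (j : ℕ) + 1 = ℓ := by omega
        rw [map_zero, hj, alpha_self, zero_smul]
    have had : (simpleGen q ℓ s .a * simpleGen q ℓ s .d) (Pi.basisFun k (Fin ℓ) j)
        = alpha q j ℓ • Pi.basisFun k (Fin ℓ) j := by
      rw [Module.End.mul_apply, simpleGen_d]
      split_ifs with h
      · rw [map_smul, simpleGen_a, dif_pos (by simp only; omega)]
        congr 2
        exact Fin.ext (by simp only; omega)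
      · rw [map_zero, show (j : ℕ) = 0 by omega, alpha_zero, zero_smul]
    rw [LinearMap.sub_apply, LinearMap.sub_apply, LinearMap.smul_apply, hda, had, hbc,
      Module.End.one_apply, smul_smul, ← sub_smul, key, sub_smul, one_smul]
  · rw [simpleGen_a_pow, dif_neg (by omega), LinearMap.zero_apply]
  · rw [simpleGen_d_pow _ _ _ _ _ (by omega), LinearMap.zero_apply]
  · rw [simpleGen_b_pow, zpow_pow_eq_one hq, one_smul, Module.End.one_apply]
  · rw [simpleGen_c_pow, zpow_pow_eq_one hq, one_smul, Module.End.one_apply]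

/-- The simple `D_n`-module `V(ℓ,s)`, of dimension `ℓ`, as a representation on `k^ℓ`. -/
noncomputable def simpleModule {n : ℕ} {q : k} (hn : 2 ≤ n) (hq : IsPrimitiveRoot q n) {ℓ : ℕ}
    (hℓ : ℓ ≤ n) (s : ZMod n) : D n q →ₐ[k] Module.End k (Fin ℓ → k) :=
  D.lift (simpleGen q ℓ s) (simpleGen_satisfies hn hq hℓ s)

/-- The componentwise action of `D_n ⊗ D_n` on `V ⊗ W`. -/
noncomputable def outerAction {n : ℕ} {q : k} {V W : Type*} [AddCommGroup V] [Module k V]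
    [AddCommGroup W] [Module k W] (ρ : D n q →ₐ[k] Module.End k V)
    (τ : D n q →ₐ[k] Module.End k W) :
    D n q ⊗[k] D n q →ₐ[k] Module.End k (V ⊗[k] W) :=
  (Module.endTensorEndAlgHom (R := k) (S := k) (A := k)).comp (Algebra.TensorProduct.map ρ τ)

/-- The tensor product of two `D_n`-modules, with `D_n` acting through the coproduct. -/
noncomputable def tensorModule {n : ℕ} [NeZero n] {q : k} (hq : IsPrimitiveRoot q n)
    {V W : Type*} [AddCommGroup V] [Module k V] [AddCommGroup W] [Module k W]
    (ρ : D n q →ₐ[k] Module.End k V) (τ : D n q →ₐ[k] Module.End k W) :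
    D n q →ₐ[k] Module.End k (V ⊗[k] W) :=
  (outerAction ρ τ).comp (comul hq)

/-- The `D_n`-module `U` is isomorphic to a direct summand of the `D_n`-module `W`: there are
`D_n`-linear maps `U → W → U` whose composition is the identity. -/
def IsSummand {n : ℕ} {q : k} {U W : Type*} [AddCommGroup U] [Module k U] [AddCommGroup W]
    [Module k W] (ρ : D n q →ₐ[k] Module.End k U) (τ : D n q →ₐ[k] Module.End k W) : Prop :=
  ∃ (ι : U →ₗ[k] W) (p : W →ₗ[k] U),
    (∀ x : D n q, ι ∘ₗ ρ x = τ x ∘ₗ ι) ∧ (∀ x : D n q, p ∘ₗ τ x = ρ x ∘ₗ p) ∧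
      p ∘ₗ ι = LinearMap.id

open Classical in
/-- The pairs `(a, b)`, `1 ≤ a ≤ n`, `b ∈ ℤ/n`, for which the simple module `V(a,b)` is a summand
of the `D_n`-module `W`. -/
noncomputable def simpleSummands {n : ℕ} [NeZero n] {q : k} (hn : 2 ≤ n)
    (hq : IsPrimitiveRoot q n) {W : Type*} [AddCommGroup W] [Module k W]
    (τ : D n q →ₐ[k] Module.End k W) : Finset (ℕ × ZMod n) :=
  (Finset.Icc 1 n ×ˢ Finset.univ).filter fun U =>
    ∃ h : U.1 ≤ n, IsSummand (simpleModule hn hq h U.2) τ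

/-- `Ř = σ ∘ 𝓡` on `V ⊗ V`, where `σ` is the interchange of the two factors. -/
noncomputable def rCheck {n : ℕ} {q : k} {V : Type*} [AddCommGroup V] [Module k V]
    (ρ : D n q →ₐ[k] Module.End k V) : Module.End k (V ⊗[k] V) :=
  (TensorProduct.comm k V V).toLinearMap ∘ₗ outerAction ρ ρ (rMatrix n q)

/-- `V ⊗ V ≃ V^{⊗2}`. -/
noncomputable def tensorTwo (k : Type*) [Field k] (V : Type*) [AddCommGroup V] [Module k V] :
    V ⊗[k] V ≃ₗ[k] ⨂[k]^2 V :=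
  (TensorProduct.congr (PiTensorProduct.subsingletonEquiv (0 : Fin 1)).symm
    (PiTensorProduct.subsingletonEquiv (0 : Fin 1)).symm).trans
    (TensorPower.mulEquiv (R := k) (M := V) (n := 1) (m := 1))

/-- The identification `V^{⊗(i-1)} ⊗ (V ⊗ V) ⊗ V^{⊗(m-i-1)} ≃ V^{⊗m}`, for `1 ≤ i ≤ m - 1`. -/
noncomputable def splitSlots (k : Type*) [Field k] (V : Type*) [AddCommGroup V] [Module k V]
    {m i : ℕ} (h1 : 1 ≤ i) (h2 : i + 1 ≤ m) :
    ((⨂[k]^(i - 1) V) ⊗[k] (V ⊗[k] V)) ⊗[k] (⨂[k]^(m - i - 1) V) ≃ₗ[k] ⨂[k]^m V :=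
  (TensorProduct.congr
      ((TensorProduct.congr (LinearEquiv.refl k _) (tensorTwo k V)).trans TensorPower.mulEquiv)
      (LinearEquiv.refl k _)).trans
    (TensorPower.mulEquiv.trans
      (TensorPower.cast k V (show i - 1 + 2 + (m - i - 1) = m by omega)))

/-- The operator `id ⊗ ⋯ ⊗ id ⊗ T ⊗ id ⊗ ⋯ ⊗ id` on `V^{⊗m}`, where the endomorphism `T` of
`V ⊗ V` occupies the slots `i` and `i + 1`, `1 ≤ i ≤ m - 1`. -/
noncomputable def atSlots {V : Type*} [AddCommGroup V] [Module k V]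
    {m i : ℕ} (h1 : 1 ≤ i) (h2 : i + 1 ≤ m) (T : Module.End k (V ⊗[k] V)) :
    Module.End k (⨂[k]^m V) :=
  (splitSlots k V h1 h2).conj
    (TensorProduct.map (TensorProduct.map LinearMap.id T) LinearMap.id)

/-- `Ř_i` on `V^{⊗m}`, `1 ≤ i ≤ m - 1`. -/
noncomputable def rCheckAt {n : ℕ} {q : k} {V : Type*} [AddCommGroup V] [Module k V]
    (ρ : D n q →ₐ[k] Module.End k V) {m i : ℕ} (h1 : 1 ≤ i) (h2 : i + 1 ≤ m) :
    Module.End k (⨂[k]^m V) :=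
  atSlots h1 h2 (rCheck ρ)

/-- The pairs `(a, b)` for which `V(a,b)` is a summand of `V(ℓ,r) ⊗ V(ℓ,r)`. -/
noncomputable def squareSummands {n : ℕ} [NeZero n] {q : k} (hn : 2 ≤ n)
    (hq : IsPrimitiveRoot q n) {ℓ : ℕ} (hℓ : ℓ ≤ n) (r : ZMod n) : Finset (ℕ × ZMod n) :=
  simpleSummands hn hq
    (tensorModule hq (simpleModule hn hq hℓ r) (simpleModule hn hq hℓ r))

/-- `c_U = q^(2r² + (2r-1)(ℓ-1) - b(a+b-1) - (n-1)(a-1)/2)` for `U = V(a,b)`, with `n` odd. The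
residues `r` and `b` are represented by integers; as `q^n = 1`, the choice does not matter. -/
noncomputable def cScalar {n : ℕ} (q : k) (ℓ : ℕ) (r : ZMod n) (U : ℕ × ZMod n) : k :=
  q ^ (2 * (r.val : ℤ) ^ 2 + (2 * (r.val : ℤ) - 1) * ((ℓ : ℤ) - 1)
    - (U.2.val : ℤ) * ((U.1 : ℤ) + (U.2.val : ℤ) - 1) - ((n : ℤ) - 1) / 2 * ((U.1 : ℤ) - 1))

end Modules

end TaftDouble

namespace TaftDouble

/-! ### The R-matrix exchanges the coproduct with its opposite -/

section Intertwining

variable {k : Type*} [Field k] {M : Type*} [Ring M] [Algebra k M] {n : ℕ} {q : k}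

/-! `Ř` commutes with `a` and `d` on V ⊗ V, and V ⊗ V is a sum of simple modules generated by lowest
weight vectors that are eigenvectors of `Ř`. So `Ř` is a scalar on each of them, and one coordinate
of the lowest weight vector determines that scalar.

Write 𝓡 = ∑ a₁^s K d₂^s / [s]! with K the Cartan part, subscripts naming the tensor factor. The
defects 𝓡Δ(x) - Δᵒᵖ(x)𝓡 for x = a, d telescope to zero (`rSum_intertwines_a`, `rSum_intertwines_d`),
and composing with the flip gives `rCheck_comm_a` and `rCheck_comm_d`. Moreover `Ř` preserves the
total degree j + j' of e_j ⊗ e_j'.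

In each degree i < ℓ the kernel of d is a line, spanned by w_i = `lowestVec q ℓ r i`, hence Ř w_i =
λ_i w_i. Only the s = 0 term applied to e_0 ⊗ e_i contributes to e_i ⊗ e_0, so λ_i is a Cartan
scalar divided by the last coefficient of w_i (`rCheck_lowestVec`); its square is c_U for U =
V(2ℓ-1-2i, 2r+i) (`rCheckEigenvalue_sq`).

The vector w_i generates a copy of U: a^(2ℓ-1-2i) w_i is killed by d and has degree at least ℓ,
where d is injective. The bound 2ℓ ≤ n+1 keeps these dimensions at most n. The sum of the copies is
direct (`squareMap_injective`), because d is nilpotent and the w_i have distinct degrees, and it is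
everything since ∑ (2ℓ-1-2i) = ℓ². Thus the product over the summands annihilates `Ř`
(`aeval_rCheck`); for this it is enough that each such U occurs among the factors. Placing an
operator in slots i, i+1 is an algebra homomorphism, which carries the identity to V^{⊗m}, and
eigenvalues are roots of an annihilating polynomial. -/

lemma qInt_one_add (q : k) (s : ℕ) : qInt q (s + 1) = 1 + q * qInt q s := by
  rw [add_comm, qInt_add]; simp [qInt]

lemma pow_mul_of_qcomm {x y : M} (h : y * x = q • (x * y)) (j : ℕ) :
    y ^ j * x = q ^ j • (x * y ^ j) := by
  induction j with
  | zero => simp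
  | succ j ih =>
    rw [pow_succ', mul_assoc, ih, mul_smul_comm, ← mul_assoc, h, smul_mul_assoc, smul_smul,
      ← pow_succ, mul_assoc]

namespace Satisfies

variable {f : Gen → M} (h : Satisfies n q f)
include h

lemma d_mul_a : f .d * f .a = q • (f .a * f .d) + (1 - f .b * f .c) := by
  rw [← h.da]; abel

lemma bc_mul_a : f .b * f .c * f .a = q ^ 2 • (f .a * (f .b * f .c)) := by
  rw [mul_assoc, h.ca, mul_smul_comm, ← mul_assoc, h.ba, smul_mul_assoc, smul_smul, ← sq,
    mul_assoc]

lemma d_mul_bc : f .d * (f .b * f .c) = q ^ 2 • (f .b * f .c * f .d) := by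
  rw [← mul_assoc, h.db, smul_mul_assoc, mul_assoc, h.dc, mul_smul_comm, smul_smul, ← sq,
    mul_assoc]

/-- Quantum analogue of the `sl₂` formula for [e, f^s]: each `a` that `d` passes leaves a factor 1 -
bc, and moving these to the right produces geometric sums that collect to [s+1](1 - q^s bc). -/
lemma d_mul_a_pow (s : ℕ) : f .d * f .a ^ (s + 1) = q ^ (s + 1) • (f .a ^ (s + 1) * f .d) +
    qInt q (s + 1) • (f .a ^ s * (1 - q ^ s • (f .b * f .c))) := by
  induction s with
  | zero => simp [h.d_mul_a, qInt]
  | succ s ih =>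
    have e : f .a ^ s * (f .b * f .c) * f .a = q ^ 2 • (f .a ^ (s + 1) * (f .b * f .c)) := by
      rw [mul_assoc, h.bc_mul_a, mul_smul_comm, ← mul_assoc, ← pow_succ]
    rw [pow_succ _ (s + 1), ← mul_assoc, ih, add_mul, smul_mul_assoc, mul_assoc _ (f .d),
      h.d_mul_a, qInt_one_add q (s + 1)]
    simp only [mul_add, mul_sub, mul_one, mul_smul_comm, smul_mul_assoc, sub_mul, e, ← pow_succ,
      ← mul_assoc (f .a ^ (s + 1)) (f .a), smul_sub, smul_add, smul_smul]
    -- The coefficients of a^(s+1) bc agree only modulo (q-1)[s+1] = q^(s+1) - 1.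
    have e2 : q ^ (s + 1) = 1 + (q - 1) * qInt q (s + 1) := by
      have : (q - 1) * qInt q (s + 1) = q ^ (s + 1) - 1 := by
        rw [mul_comm]; exact geom_sum_mul q (s + 1)
      rw [this]; ring
    match_scalars
    · ring
    · linear_combination e2
    · ring

lemma d_pow_mul_a (s : ℕ) : f .d ^ (s + 1) * f .a = q ^ (s + 1) • (f .a * f .d ^ (s + 1)) +
    qInt q (s + 1) • ((1 - q ^ s • (f .b * f .c)) * f .d ^ s) := by
  induction s with
  | zero => simp [h.d_mul_a, qInt]
  | succ s ih =>
    have e : f .d * (f .b * f .c * f .d ^ s) = q ^ 2 • (f .b * f .c * f .d ^ (s + 1)) := by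
      rw [← mul_assoc, h.d_mul_bc, smul_mul_assoc, mul_assoc, ← pow_succ']
    rw [pow_succ' _ (s + 1), mul_assoc, ih, mul_add, mul_smul_comm, ← mul_assoc (f .d) (f .a),
      h.d_mul_a, qInt_one_add q (s + 1)]
    simp only [add_mul, sub_mul, one_mul, mul_smul_comm, smul_mul_assoc, mul_sub, e, ← pow_succ',
      mul_assoc (f .a) (f .d), smul_sub, smul_add, smul_smul]
    have e2 : q ^ (s + 1) = 1 + (q - 1) * qInt q (s + 1) := by
      have : (q - 1) * qInt q (s + 1) = q ^ (s + 1) - 1 := by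
        rw [mul_comm]; exact geom_sum_mul q (s + 1)
      rw [this]; ring
    match_scalars
    · ring
    · linear_combination e2
    · ring

end Satisfies

/-- The sum `∑_s (1/[s]!) a₁^s K d₂^s`. -/
noncomputable def rSum (n : ℕ) (q : k) (f g : Gen → M) (K : M) : M :=
  ∑ s ∈ Finset.range n, (qFact q s)⁻¹ • (f .a ^ s * K * g .d ^ s)

variable {f g : Gen → M} {K : M}

/-- This is 𝓡Δ(d) = Δᵒᵖ(d)𝓡. Let T_s be the s-th term of the sum. By `d_mul_a_pow`, d₁T_s - T_s d₁c₂
is the boundary term G s, while T_s d₂ - c₁d₂T_s is G (s+1). The relations assumed for K are those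
of the Cartan part on weight vectors. -/
lemma rSum_intertwines_d [NeZero n] (hq : IsPrimitiveRoot q n) (hf : Satisfies n q f)
    (hg : Satisfies n q g) (hfg : ∀ x y, Commute (f x) (g y))
    (hd1 : f .d * K = K * (f .d * g .c)) (hd2 : g .d * K = K * (f .b * g .d))
    (hb1 : Commute K (f .b)) :
    rSum n q f g K * (f .d * g .c + g .d) = (f .c * g .d + f .d) * rSum n q f g K := by
  let G : ℕ → M := fun s => match s with
    | 0 => 0
    | s + 1 => (qFact q s)⁻¹ • (f .a ^ s * (1 - q ^ s • (f .b * f .c)) * K * g .d ^ (s + 1))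
  rw [← sub_eq_zero, ← neg_eq_zero, neg_sub]
  have key : ∀ s ∈ Finset.range n,
      (f .c * g .d + f .d) * ((qFact q s)⁻¹ • (f .a ^ s * K * g .d ^ s)) -
        ((qFact q s)⁻¹ • (f .a ^ s * K * g .d ^ s)) * (f .d * g .c + g .d) = G s - G (s + 1) := by
    intro s hs
    have hs := Finset.mem_range.mp hs
    have t1 : f .a ^ s * K * g .d ^ s * g .d = f .a ^ s * K * g .d ^ (s + 1) := by
      rw [mul_assoc, ← pow_succ]
    have t2 : f .a ^ s * K * g .d ^ s * (f .d * g .c) =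
        q ^ s • (f .a ^ s * f .d * K * g .d ^ s) := by
      have e : g .d ^ s * (f .d * g .c) = q ^ s • (f .d * g .c * g .d ^ s) := by
        rw [← mul_assoc, ((hfg .d .d).pow_right s).eq.symm, mul_assoc, pow_mul_of_qcomm hg.dc,
          mul_smul_comm, mul_assoc]
      rw [mul_assoc, e, mul_smul_comm, mul_assoc, ← mul_assoc K, ← hd1]
      simp only [mul_assoc]
    have t3 : f .c * g .d * (f .a ^ s * K * g .d ^ s) =
        q ^ s • (f .a ^ s * (f .b * f .c) * K * g .d ^ (s + 1)) := by
      have e : f .c * g .d * (f .a ^ s * K * g .d ^ s)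
          = f .c * f .a ^ s * (g .d * K) * g .d ^ s := by
        simp only [mul_assoc]
        rw [← mul_assoc (g .d) (f .a ^ s), ← ((hfg .a .d).pow_left s).eq]
        simp only [mul_assoc]
      rw [e, hd2, mul_pow_of_qcomm hf.ca, smul_mul_assoc, smul_mul_assoc, ← mul_assoc K, hb1.eq,
        hf.bc, pow_succ']
      simp only [mul_assoc]
    rw [mul_smul_comm, smul_mul_assoc, mul_add, t1, t2, add_mul, t3]
    cases s with
    | zero =>
      simp [G, qFact]
      rw [sub_mul, sub_mul]
      simp only [one_mul]
      abel
    | succ s =>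
      have hne := qInt_ne_zero hq (Nat.succ_pos s) hs
      have hne' := qFact_ne_zero hq (m := s) (by omega)
      have t4 : f .d * (f .a ^ (s + 1) * K * g .d ^ (s + 1)) =
          q ^ (s + 1) • (f .a ^ (s + 1) * f .d * K * g .d ^ (s + 1)) +
          qInt q (s + 1) • (f .a ^ s * (1 - q ^ s • (f .b * f .c)) * K * g .d ^ (s + 1)) := by
        rw [← mul_assoc, ← mul_assoc, hf.d_mul_a_pow]
        simp only [add_mul, smul_mul_assoc]
      have t5 : f .a ^ (s + 1) * (1 - q ^ (s + 1) • (f .b * f .c)) * K * g .d ^ (s + 1 + 1) =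
          f .a ^ (s + 1) * K * g .d ^ (s + 1 + 1) - q ^ (s + 1) • (f .a ^ (s + 1) * (f .b * f .c) *
            K * g .d ^ (s + 1 + 1)) := by
        simp only [mul_sub, sub_mul, mul_one, mul_smul_comm, smul_mul_assoc]
      simp only [G]
      rw [t4, t5, qFact_succ]
      match_scalars <;> (field_simp; try ring_nf)
  rw [rSum, Finset.mul_sum, Finset.sum_mul, ← Finset.sum_sub_distrib, Finset.sum_congr rfl key,
    Finset.sum_range_sub']
  -- G 0 vanishes by definition and G n contains d₂^n = 0.
  obtain ⟨t, ht⟩ : ∃ t, n = t + 1 := ⟨n - 1, by have := NeZero.pos n; omega⟩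
  have : g .d ^ (t + 1) = 0 := ht ▸ hg.d_pow
  simp [G, ht, this]

/-- The mirror image, 𝓡Δ(a) = Δᵒᵖ(a)𝓡: now `d_pow_mul_a` in the second factor gives T_s a₂ - b₁a₂T_s
= G s, and a₁T_s - T_s a₁b₂ = G (s+1). The last boundary term dies because a₁^n = 0. -/
lemma rSum_intertwines_a [NeZero n] (hq : IsPrimitiveRoot q n) (hf : Satisfies n q f)
    (hg : Satisfies n q g) (hfg : ∀ x y, Commute (f x) (g y))
    (ha1 : K * f .a = f .a * g .c * K) (ha2 : K * g .a = f .b * g .a * K)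
    (hb2 : Commute K (g .b)) (hc2 : Commute K (g .c)) :
    rSum n q f g K * (f .a * g .b + g .a) = (f .b * g .a + f .a) * rSum n q f g K := by
  let G : ℕ → M := fun s => match s with
    | 0 => 0
    | s + 1 => (qFact q s)⁻¹ • (f .a ^ (s + 1) * K * (1 - q ^ s • (g .b * g .c)) * g .d ^ s)
  rw [← sub_eq_zero]
  have key : ∀ s ∈ Finset.range n,
      ((qFact q s)⁻¹ • (f .a ^ s * K * g .d ^ s)) * (f .a * g .b + g .a) -
      (f .b * g .a + f .a) * ((qFact q s)⁻¹ • (f .a ^ s * K * g .d ^ s)) = G s - G (s + 1) := by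
    intro s hs
    have hs := Finset.mem_range.mp hs
    have t1 : f .a * (f .a ^ s * K * g .d ^ s) = f .a ^ (s + 1) * K * g .d ^ s := by
      rw [← mul_assoc, ← mul_assoc, ← pow_succ']
    have t2 : f .a ^ s * K * g .d ^ s * (f .a * g .b) =
        q ^ s • (f .a ^ (s + 1) * K * (g .b * g .c) * g .d ^ s) := by
      have e : g .d ^ s * (f .a * g .b) = q ^ s • (f .a * g .b * g .d ^ s) := by
        rw [← mul_assoc, ((hfg .a .d).pow_right s).eq.symm, mul_assoc, pow_mul_of_qcomm hg.db,
          mul_smul_comm, mul_assoc]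
      have e2 : K * (f .a * g .b) = f .a * K * (g .b * g .c) := by
        rw [hg.bc, ← mul_assoc, ha1, mul_assoc _ K, hb2.eq, mul_assoc (f .a) K, ← mul_assoc K,
          hc2.eq]
        rw [mul_assoc (g .c) K, hb2.eq]
        simp only [mul_assoc]
      rw [mul_assoc, e, mul_smul_comm, mul_assoc, ← mul_assoc K, e2, pow_succ]
      simp only [mul_assoc]
    have t3 : f .b * g .a * (f .a ^ s * K * g .d ^ s) =
        q ^ s • (f .a ^ s * K * (g .a * g .d ^ s)) := by
      have e : f .b * g .a * (f .a ^ s * K * g .d ^ s)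
          = f .b * f .a ^ s * g .a * K * g .d ^ s := by
        simp only [mul_assoc]
        rw [← mul_assoc (g .a) (f .a ^ s), ← ((hfg .a .a).pow_left s).eq]
        simp only [mul_assoc]
      rw [e, mul_pow_of_qcomm hf.ba]
      simp only [smul_mul_assoc]
      rw [mul_assoc _ (f .b), mul_assoc _ (f .b * g .a), ← ha2]
      simp only [mul_assoc]
    rw [mul_smul_comm, smul_mul_assoc, mul_add, t2, add_mul, t1, t3]
    cases s with
    | zero =>
      simp [G, qFact]
      rw [mul_sub]
      simp only [mul_one]
      abel
    | succ s =>
      have hne := qInt_ne_zero hq (Nat.succ_pos s) hs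
      have hne' := qFact_ne_zero hq (m := s) (by omega)
      have t4 : f .a ^ (s + 1) * K * g .d ^ (s + 1) * g .a =
          q ^ (s + 1) • (f .a ^ (s + 1) * K * (g .a * g .d ^ (s + 1))) +
          qInt q (s + 1) • (f .a ^ (s + 1) * K * (1 - q ^ s • (g .b * g .c)) * g .d ^ s) := by
        rw [mul_assoc, hg.d_pow_mul_a]
        simp only [mul_add, mul_smul_comm, mul_assoc]
      have t5 : f .a ^ (s + 1 + 1) * K * (1 - q ^ (s + 1) • (g .b * g .c)) * g .d ^ (s + 1) =
          f .a ^ (s + 1 + 1) * K * g .d ^ (s + 1) - q ^ (s + 1) • (f .a ^ (s + 1 + 1) * K *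
            (g .b * g .c) * g .d ^ (s + 1)) := by
        simp only [mul_sub, sub_mul, mul_one, mul_smul_comm, smul_mul_assoc]
      simp only [G]
      rw [t4, t5, qFact_succ]
      match_scalars <;> (field_simp; try ring_nf)
  rw [rSum, Finset.mul_sum, Finset.sum_mul, ← Finset.sum_sub_distrib, Finset.sum_congr rfl key,
    Finset.sum_range_sub']
  obtain ⟨t, ht⟩ : ∃ t, n = t + 1 := ⟨n - 1, by have := NeZero.pos n; omega⟩
  have : f .a ^ (t + 1) = 0 := ht ▸ hf.a_pow
  simp [G, ht, this]

end Intertwining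

/-! ### The Cartan part of the R-matrix and character sums -/

section RMatrix

variable {k : Type*} [Field k] {n : ℕ} {q : k}

lemma Satisfies.map {A B : Type*} [Ring A] [Algebra k A] [Ring B] [Algebra k B] {f : Gen → A}
    (h : Satisfies n q f) (φ : A →ₐ[k] B) : Satisfies n q (fun x => φ (f x)) where
  ba := by simpa using congrArg φ h.ba
  db := by simpa using congrArg φ h.db
  bc := by simpa using congrArg φ h.bc
  ca := by simpa using congrArg φ h.ca
  dc := by simpa using congrArg φ h.dc
  da := by simpa using congrArg φ h.da
  a_pow := by simpa using congrArg φ h.a_pow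
  d_pow := by simpa using congrArg φ h.d_pow
  b_pow := by simpa using congrArg φ h.b_pow
  c_pow := by simpa using congrArg φ h.c_pow

/-- The generators in the first factor of `D_n ⊗ D_n`. -/
def genLeft (n : ℕ) (q : k) (x : Gen) : D n q ⊗[k] D n q := D.of n q x ⊗ₜ 1

/-- The generators in the second factor of `D_n ⊗ D_n`. -/
def genRight (n : ℕ) (q : k) (x : Gen) : D n q ⊗[k] D n q := 1 ⊗ₜ D.of n q x

lemma genLeft_satisfies (n : ℕ) (q : k) : Satisfies n q (genLeft n q) := by
  let φ : D n q →ₐ[k] D n q ⊗[k] D n q := Algebra.TensorProduct.includeLeft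
  exact (D.satisfies n q).map (B := D n q ⊗[k] D n q) φ

lemma genRight_satisfies (n : ℕ) (q : k) : Satisfies n q (genRight n q) := by
  let φ : D n q →ₐ[k] D n q ⊗[k] D n q := Algebra.TensorProduct.includeRight
  exact (D.satisfies n q).map (B := D n q ⊗[k] D n q) φ

lemma genLeft_commute_genRight (x y : Gen) : Commute (genLeft n q x) (genRight n q y) := by
  simp [Commute, SemiconjBy, genLeft, genRight]

/-- The Cartan part `(1/n) ∑_{m,t} q^(-tm) b^t ⊗ c^m` of the R-matrix. -/
noncomputable def rCartan (n : ℕ) (q : k) : D n q ⊗[k] D n q :=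
  (1 / (n : k)) • ∑ m ∈ Finset.range n, ∑ t ∈ Finset.range n,
    q ^ (-((t : ℤ) * (m : ℤ))) • (genLeft n q .b ^ t * genRight n q .c ^ m)

lemma rMatrix_eq_rSum (n : ℕ) (q : k) :
    rMatrix n q = rSum n q (genLeft n q) (genRight n q) (rCartan n q) := by
  simp only [rMatrix, rSum, rCartan, mul_smul_comm, smul_mul_assoc, Finset.mul_sum,
    Finset.sum_mul, Finset.smul_sum]
  rw [Finset.sum_comm]
  refine Finset.sum_congr rfl fun s _ => Finset.sum_congr rfl fun m _ =>
    Finset.sum_congr rfl fun t _ => ?_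
  simp only [genLeft, genRight, Algebra.TensorProduct.tmul_pow, one_pow,
    Algebra.TensorProduct.tmul_mul_tmul, one_mul, mul_one, smul_smul]
  congr 1
  ring

/-- Orthogonality of the characters of ℤ/n: the sum over t keeps only m ≡ u mod n. Hence K scales a
vector of b-weight q^u and c-weight q^v by q^(uv). -/
lemma sum_zpow_characters [CharZero k] [NeZero n] (hq : IsPrimitiveRoot q n) (u v : ℤ) :
    (1 / (n : k)) * ∑ m ∈ Finset.range n, ∑ t ∈ Finset.range n,
      q ^ (-((t : ℤ) * (m : ℤ))) * ((q ^ u) ^ t * (q ^ v) ^ m) = q ^ (u * v) := by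
  have hn : (n : k) ≠ 0 := Nat.cast_ne_zero.mpr (NeZero.ne n)
  have h0 : q ≠ 0 := hq.ne_zero (NeZero.ne n)
  have hnz : (n : ℤ) ≠ 0 := Nat.cast_ne_zero.mpr (NeZero.ne n)
  obtain ⟨m₀, hm₀⟩ : ∃ m₀ : ℕ, (m₀ : ℤ) = u % n :=
    ⟨(u % n).toNat, Int.toNat_of_nonneg (Int.emod_nonneg _ hnz)⟩
  have hlt : m₀ < n := by
    have := Int.emod_lt_of_pos u (show (0 : ℤ) < n by have := NeZero.pos n; omega)
    omega
  have hdvd : (n : ℤ) ∣ u - m₀ := by rw [hm₀]; exact Int.dvd_self_sub_emod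
  have inner : ∀ m ∈ Finset.range n, ∑ t ∈ Finset.range n,
      q ^ (-((t : ℤ) * (m : ℤ))) * ((q ^ u) ^ t * (q ^ v) ^ m)
        = if m = m₀ then (n : k) * (q ^ v) ^ m else 0 := by
    intro m hm
    have hm := Finset.mem_range.mp hm
    have e : ∀ t : ℕ, q ^ (-((t : ℤ) * (m : ℤ))) * ((q ^ u) ^ t * (q ^ v) ^ m)
        = (q ^ (u - m)) ^ t * (q ^ v) ^ m := by
      intro t
      rw [← mul_assoc]
      congr 1
      rw [← zpow_natCast, ← zpow_natCast, ← zpow_mul, ← zpow_mul, ← zpow_add₀ h0]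
      congr 1
      ring
    simp only [e]
    rw [← Finset.sum_mul]
    split_ifs with h
    · have : q ^ (u - m) = 1 := (hq.zpow_eq_one_iff_dvd _).mpr (h ▸ hdvd)
      simp [this]
    · have hne : q ^ (u - m) ≠ 1 := by
        intro h1
        have h2 := (hq.zpow_eq_one_iff_dvd _).mp h1
        have h3 : (n : ℤ) ∣ m - m₀ := by
          have := dvd_sub hdvd h2
          rwa [sub_sub_sub_cancel_left] at this
        have h4 := Int.eq_zero_of_abs_lt_dvd h3 (by rw [abs_lt]; omega)
        omega
      have := geom_sum_mul (q ^ (u - m)) n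
      rw [zpow_pow_eq_one hq, sub_self] at this
      rw [(mul_eq_zero.mp this).resolve_right (sub_ne_zero.mpr hne), zero_mul]
  rw [Finset.sum_congr rfl inner, Finset.sum_ite_eq', if_pos (Finset.mem_range.mpr hlt),
    ← mul_assoc, one_div, inv_mul_cancel₀ hn, one_mul, ← zpow_natCast, ← zpow_mul]
  obtain ⟨w, hw⟩ := hdvd
  have : u * v = v * m₀ + n * (w * v) := by linear_combination v * hw
  rw [this, zpow_add₀ h0, zpow_mul q n, zpow_natCast, hq.pow_eq_one, one_zpow, mul_one]

end RMatrix

/-! ### The action on the extended basis of V(ℓ,s) -/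

section StandardVectors

variable {k : Type*} [Field k] {n : ℕ} {q : k}

/-- The standard basis vectors of `k^ℓ`, extended by zero to all indices. -/
noncomputable def stdVec (k : Type*) [Field k] (ℓ j : ℕ) : Fin ℓ → k :=
  if h : j < ℓ then Pi.basisFun k (Fin ℓ) ⟨j, h⟩ else 0

lemma stdVec_of_lt {ℓ j : ℕ} (h : j < ℓ) : stdVec k ℓ j = Pi.basisFun k (Fin ℓ) ⟨j, h⟩ := dif_pos h

lemma stdVec_of_le {ℓ j : ℕ} (h : ℓ ≤ j) : stdVec k ℓ j = 0 := dif_neg (by omega)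

lemma stdVec_fin {ℓ : ℕ} (j : Fin ℓ) : stdVec k ℓ j = Pi.basisFun k (Fin ℓ) j :=
  stdVec_of_lt j.isLt

lemma stdVec_ext {ℓ : ℕ} {X : Type*} [AddCommGroup X] [Module k X] {S T : (Fin ℓ → k) →ₗ[k] X}
    (h : ∀ j < ℓ, S (stdVec k ℓ j) = T (stdVec k ℓ j)) : S = T :=
  (Pi.basisFun k (Fin ℓ)).ext fun j => by rw [← stdVec_fin]; exact h j j.isLt

lemma stdVec_tmul_ext {ℓ : ℕ} {X : Type*} [AddCommGroup X] [Module k X]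
    {S T : (Fin ℓ → k) ⊗[k] (Fin ℓ → k) →ₗ[k] X}
    (h : ∀ j < ℓ, ∀ j' < ℓ, S (stdVec k ℓ j ⊗ₜ stdVec k ℓ j') = T (stdVec k ℓ j ⊗ₜ stdVec k ℓ j')) :
    S = T :=
  TensorProduct.ext (stdVec_ext fun j hj => stdVec_ext fun j' hj' => h j hj j' hj')

variable (hn : 2 ≤ n) (hq : IsPrimitiveRoot q n) {ℓ : ℕ} (hℓ : ℓ ≤ n) (s : ZMod n) (j : ℕ)

lemma simpleModule_of (x : Gen) : simpleModule hn hq hℓ s (D.of n q x) = simpleGen q ℓ s x :=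
  D.lift_of _ _ _

lemma simpleModule_a : simpleModule hn hq hℓ s (D.of n q .a) (stdVec k ℓ j)
    = stdVec k ℓ (j + 1) := by
  rw [simpleModule_of]
  rcases lt_or_ge j ℓ with h | h
  · rw [stdVec_of_lt h, simpleGen_a]; rfl
  · rw [stdVec_of_le h, stdVec_of_le (by omega), map_zero]

lemma simpleModule_b : simpleModule hn hq hℓ s (D.of n q .b) (stdVec k ℓ j)
    = q ^ ((s.val : ℤ) + j) • stdVec k ℓ j := by
  rw [simpleModule_of]
  rcases lt_or_ge j ℓ with h | h
  · rw [stdVec_of_lt h, simpleGen_b]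
  · rw [stdVec_of_le h, map_zero, smul_zero]

lemma simpleModule_c : simpleModule hn hq hℓ s (D.of n q .c) (stdVec k ℓ j)
    = q ^ ((j : ℤ) + 1 - (s.val + ℓ)) • stdVec k ℓ j := by
  rw [simpleModule_of]
  rcases lt_or_ge j ℓ with h | h
  · rw [stdVec_of_lt h, simpleGen_c]
  · rw [stdVec_of_le h, map_zero, smul_zero]

/-- The boundary cases are absorbed by the coefficient: α_0 = 0 makes the truncated j - 1 harmless,
and α_ℓ(ℓ) = 0 covers j = ℓ. -/
lemma simpleModule_d : simpleModule hn hq hℓ s (D.of n q .d) (stdVec k ℓ j)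
    = alpha q j ℓ • stdVec k ℓ (j - 1) := by
  rw [simpleModule_of]
  rcases lt_trichotomy j ℓ with h | h | h
  · rw [stdVec_of_lt h, simpleGen_d]
    rcases Nat.eq_zero_or_pos j with rfl | h0
    · simp [alpha_zero]
    · rw [stdVec_of_lt (show j - 1 < ℓ by omega)]
      exact if_pos h0
  · rw [h, alpha_self, stdVec_of_le le_rfl, map_zero, zero_smul]
  · rw [stdVec_of_le h.le, stdVec_of_le (by omega), map_zero, smul_zero]

include hq in
-- The exponents i and i - ℓ are nonzero and of absolute value less than n.
lemma alpha_ne_zero {i : ℕ} (h0 : 0 < i) (hi : i < ℓ) (hℓ : ℓ ≤ n) : alpha q i ℓ ≠ 0 := by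
  have hz : q ≠ 0 := hq.ne_zero (by omega)
  refine div_ne_zero (mul_ne_zero ?_ ?_) (sub_ne_zero.mpr (hq.ne_one (by omega)))
  · exact sub_ne_zero.mpr (hq.pow_ne_one_of_pos_of_lt h0.ne' (by omega))
  · rw [sub_ne_zero]
    intro h
    have h1 := Int.eq_zero_of_abs_lt_dvd ((hq.zpow_eq_one_iff_dvd _).mp h.symm)
      (by rw [abs_lt]; omega)
    omega

end StandardVectors

/-! ### The action on V ⊗ V -/

section TensorSquare

variable {k : Type*} [Field k] {n : ℕ} {q : k}

section General

variable {V : Type*} [AddCommGroup V] [Module k V] (hq : IsPrimitiveRoot q n)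
  (ρ : D n q →ₐ[k] Module.End k V) (v w : V)

@[simp] lemma outerAction_genLeft (x : Gen) :
    outerAction ρ ρ (genLeft n q x) (v ⊗ₜ w) = ρ (D.of n q x) v ⊗ₜ w := by
  simp [outerAction, genLeft, Module.endTensorEndAlgHom_apply]

@[simp] lemma outerAction_genRight (x : Gen) :
    outerAction ρ ρ (genRight n q x) (v ⊗ₜ w) = v ⊗ₜ ρ (D.of n q x) w := by
  simp [outerAction, genRight, Module.endTensorEndAlgHom_apply]

lemma comul_of [NeZero n] (x : Gen) : comul hq (D.of n q x) = comulGen n q x := D.lift_of _ _ _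

lemma comulGen_a : comulGen n q .a = genLeft n q .a * genRight n q .b + genRight n q .a := by
  simp [comulGen, genLeft, genRight]

lemma comulGen_b : comulGen n q .b = genLeft n q .b * genRight n q .b := by
  simp [comulGen, genLeft, genRight]

lemma comulGen_c : comulGen n q .c = genLeft n q .c * genRight n q .c := by
  simp [comulGen, genLeft, genRight]

lemma comulGen_d : comulGen n q .d = genLeft n q .d * genRight n q .c + genRight n q .d := by
  simp [comulGen, genLeft, genRight]

lemma tensorModule_of [NeZero n] (x : Gen) :
    tensorModule hq ρ ρ (D.of n q x) = outerAction ρ ρ (comulGen n q x) := by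
  rw [tensorModule, AlgHom.comp_apply, comul_of]

end General

variable [NeZero n] (hn : 2 ≤ n) (hq : IsPrimitiveRoot q n) {ℓ : ℕ} (hℓ : ℓ ≤ n) (r : ZMod n) (j j' : ℕ)

lemma tensorSquare_a : tensorModule hq (simpleModule hn hq hℓ r) (simpleModule hn hq hℓ r)
      (D.of n q .a) (stdVec k ℓ j ⊗ₜ stdVec k ℓ j') =
    q ^ ((r.val : ℤ) + j') • (stdVec k ℓ (j + 1) ⊗ₜ[k] stdVec k ℓ j') +
      stdVec k ℓ j ⊗ₜ stdVec k ℓ (j' + 1) := by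
  simp [tensorModule_of, comulGen_a, simpleModule_a, simpleModule_b]

lemma tensorSquare_b : tensorModule hq (simpleModule hn hq hℓ r) (simpleModule hn hq hℓ r)
      (D.of n q .b) (stdVec k ℓ j ⊗ₜ stdVec k ℓ j') =
    q ^ (2 * (r.val : ℤ) + (j + j' : ℕ)) • (stdVec k ℓ j ⊗ₜ[k] stdVec k ℓ j') := by
  simp [tensorModule_of, comulGen_b, simpleModule_b, TensorProduct.smul_tmul', smul_smul]
  rw [← zpow_add₀ (hq.ne_zero (NeZero.ne n))]
  congr 2
  ring_nf

lemma tensorSquare_c : tensorModule hq (simpleModule hn hq hℓ r) (simpleModule hn hq hℓ r)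
      (D.of n q .c) (stdVec k ℓ j ⊗ₜ stdVec k ℓ j') =
    q ^ (((j + j' : ℕ) : ℤ) + 2 - 2 * (r.val + ℓ)) • (stdVec k ℓ j ⊗ₜ[k] stdVec k ℓ j') := by
  simp [tensorModule_of, comulGen_c, simpleModule_c, TensorProduct.smul_tmul', smul_smul]
  rw [← zpow_add₀ (hq.ne_zero (NeZero.ne n))]
  congr 2
  ring_nf

lemma tensorSquare_d : tensorModule hq (simpleModule hn hq hℓ r) (simpleModule hn hq hℓ r)
      (D.of n q .d) (stdVec k ℓ j ⊗ₜ stdVec k ℓ j') =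
    (alpha q j ℓ * q ^ ((j' : ℤ) + 1 - (r.val + ℓ))) •
        (stdVec k ℓ (j - 1) ⊗ₜ[k] stdVec k ℓ j') +
      alpha q j' ℓ • (stdVec k ℓ j ⊗ₜ stdVec k ℓ (j' - 1)) := by
  simp [tensorModule_of, comulGen_d, simpleModule_d, simpleModule_c, TensorProduct.smul_tmul',
    smul_smul, mul_comm]

/-- The scalar by which the Cartan part of the R-matrix acts on `e_j ⊗ e_j'`. -/
noncomputable def cartanScalar (q : k) (ℓ : ℕ) (r : ZMod n) (j j' : ℕ) : k :=
  q ^ (((r.val : ℤ) + j) * ((j' : ℤ) + 1 - (r.val + ℓ)))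

lemma outerAction_rCartan [CharZero k] :
    outerAction (simpleModule hn hq hℓ r) (simpleModule hn hq hℓ r) (rCartan n q)
      (stdVec k ℓ j ⊗ₜ stdVec k ℓ j') =
    cartanScalar q ℓ r j j' • (stdVec k ℓ j ⊗ₜ[k] stdVec k ℓ j') := by
  have hb : ∀ t : ℕ, (outerAction (simpleModule hn hq hℓ r) (simpleModule hn hq hℓ r)
      (genLeft n q .b) ^ t) (stdVec k ℓ j ⊗ₜ stdVec k ℓ j') =
      (q ^ ((r.val : ℤ) + j)) ^ t • (stdVec k ℓ j ⊗ₜ[k] stdVec k ℓ j') := by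
    intro t
    induction t with
    | zero => simp
    | succ t ih =>
      rw [pow_succ', Module.End.mul_apply, ih, map_smul, outerAction_genLeft, simpleModule_b,
        ← TensorProduct.smul_tmul', smul_smul, ← pow_succ]
  have hc : ∀ t : ℕ, (outerAction (simpleModule hn hq hℓ r) (simpleModule hn hq hℓ r)
      (genRight n q .c) ^ t) (stdVec k ℓ j ⊗ₜ stdVec k ℓ j') =
      (q ^ ((j' : ℤ) + 1 - (r.val + ℓ))) ^ t • (stdVec k ℓ j ⊗ₜ[k] stdVec k ℓ j') := by
    intro t
    induction t with
    | zero => simp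
    | succ t ih =>
      rw [pow_succ', Module.End.mul_apply, ih, map_smul, outerAction_genRight, simpleModule_c,
        TensorProduct.tmul_smul, smul_smul, ← pow_succ]
  rw [cartanScalar, ← sum_zpow_characters hq]
  simp only [rCartan, map_smul, map_sum, map_mul, map_pow, LinearMap.smul_apply,
    LinearMap.sum_apply, Module.End.mul_apply, hc, hb, smul_smul, Finset.sum_smul, Finset.mul_sum,
    Finset.smul_sum]
  refine Finset.sum_congr rfl fun m _ => Finset.sum_congr rfl fun t _ => ?_
  congr 1
  ring

end TensorSquare

/-! ### `Ř` commutes with a and d -/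

section RCheck

variable {k : Type*} [Field k] {n : ℕ} [NeZero n] {q : k}

lemma cartanScalar_succ_left (hq : IsPrimitiveRoot q n) (ℓ : ℕ) (r : ZMod n) (j j' : ℕ) :
    cartanScalar q ℓ r (j + 1) j' = cartanScalar q ℓ r j j' * q ^ ((j' : ℤ) + 1 - (r.val + ℓ)) := by
  rw [cartanScalar, cartanScalar, ← zpow_add₀ (hq.ne_zero (NeZero.ne n))]
  congr 1
  push_cast
  ring

lemma cartanScalar_succ_right (hq : IsPrimitiveRoot q n) (ℓ : ℕ) (r : ZMod n) (j j' : ℕ) :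
    cartanScalar q ℓ r j (j' + 1) = cartanScalar q ℓ r j j' * q ^ ((r.val : ℤ) + j) := by
  rw [cartanScalar, cartanScalar, ← zpow_add₀ (hq.ne_zero (NeZero.ne n))]
  congr 1
  push_cast
  ring

section Commutation

variable {V : Type*} [AddCommGroup V] [Module k V]
  (ρ : D n q →ₐ[k] Module.End k V)

omit [NeZero n] in
lemma outerAction_rMatrix :
    outerAction ρ ρ (rMatrix n q) = rSum n q (fun x => outerAction ρ ρ (genLeft n q x))
      (fun x => outerAction ρ ρ (genRight n q x)) (outerAction ρ ρ (rCartan n q)) := by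
  rw [rMatrix_eq_rSum]
  simp only [rSum, map_sum, map_smul, map_mul, map_pow]

end Commutation

variable [CharZero k] (hn : 2 ≤ n) (hq : IsPrimitiveRoot q n) {ℓ : ℕ} (hℓ : ℓ ≤ n) (r : ZMod n)

lemma rCheck_comm_d :
    rCheck (simpleModule hn hq hℓ r) *
        tensorModule hq (simpleModule hn hq hℓ r) (simpleModule hn hq hℓ r) (D.of n q .d) =
      tensorModule hq (simpleModule hn hq hℓ r) (simpleModule hn hq hℓ r) (D.of n q .d) *
        rCheck (simpleModule hn hq hℓ r) := by
  set ρ := simpleModule hn hq hℓ r with hρ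
  have key := rSum_intertwines_d (f := fun x => outerAction ρ ρ (genLeft n q x))
    (g := fun x => outerAction ρ ρ (genRight n q x)) (K := outerAction ρ ρ (rCartan n q)) hq
    ((genLeft_satisfies n q).map _) ((genRight_satisfies n q).map _)
    (fun x y => (genLeft_commute_genRight x y).map (outerAction ρ ρ)) ?_ ?_ ?_
  -- The flip turns Δᵒᵖ(d) into Δ(d).
  · have hsw : (TensorProduct.comm k (Fin ℓ → k) (Fin ℓ → k)).toLinearMap ∘ₗ
        (outerAction ρ ρ (genLeft n q .c) * outerAction ρ ρ (genRight n q .d) +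
          outerAction ρ ρ (genLeft n q .d)) =
        outerAction ρ ρ (comulGen n q .d) ∘ₗ
          (TensorProduct.comm k (Fin ℓ → k) (Fin ℓ → k)).toLinearMap :=
      TensorProduct.ext' fun v w => by simp [comulGen_d, add_comm]
    rw [tensorModule_of, rCheck, outerAction_rMatrix]
    have e : outerAction ρ ρ (comulGen n q .d) = outerAction ρ ρ (genLeft n q .d) *
        outerAction ρ ρ (genRight n q .c) + outerAction ρ ρ (genRight n q .d) := by
      simp [comulGen_d]
    rw [Module.End.mul_eq_comp, Module.End.mul_eq_comp, ← LinearMap.comp_assoc, ← hsw,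
      LinearMap.comp_assoc, LinearMap.comp_assoc, e]
    exact congrArg _ key
  -- The relations required of K compare Cartan scalars at neighbouring indices.
  · refine stdVec_tmul_ext fun j _ j' _ => ?_
    simp only [Module.End.mul_apply, hρ, outerAction_rCartan, outerAction_genLeft,
      outerAction_genRight, map_smul, simpleModule_d, simpleModule_c, ← TensorProduct.smul_tmul',
      TensorProduct.tmul_smul, smul_smul]
    rcases j with _ | j
    · simp [alpha_zero]
    · rw [cartanScalar_succ_left hq, Nat.add_sub_cancel]
      congr 1
      ring
  · refine stdVec_tmul_ext fun j _ j' _ => ?_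
    simp only [Module.End.mul_apply, hρ, outerAction_rCartan, outerAction_genLeft,
      outerAction_genRight, map_smul, simpleModule_d, simpleModule_b, ← TensorProduct.smul_tmul',
      TensorProduct.tmul_smul, smul_smul]
    rcases j' with _ | j'
    · simp [alpha_zero]
    · rw [cartanScalar_succ_right hq, Nat.add_sub_cancel]
      congr 1
      ring
  · refine stdVec_tmul_ext fun j _ j' _ => ?_
    simp only [Module.End.mul_apply, hρ, outerAction_rCartan, outerAction_genLeft,
      map_smul, simpleModule_b, ← TensorProduct.smul_tmul', smul_smul, mul_comm]

lemma rCheck_comm_a :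
    rCheck (simpleModule hn hq hℓ r) *
        tensorModule hq (simpleModule hn hq hℓ r) (simpleModule hn hq hℓ r) (D.of n q .a) =
      tensorModule hq (simpleModule hn hq hℓ r) (simpleModule hn hq hℓ r) (D.of n q .a) *
        rCheck (simpleModule hn hq hℓ r) := by
  set ρ := simpleModule hn hq hℓ r with hρ
  have key := rSum_intertwines_a (f := fun x => outerAction ρ ρ (genLeft n q x))
    (g := fun x => outerAction ρ ρ (genRight n q x)) (K := outerAction ρ ρ (rCartan n q)) hq
    ((genLeft_satisfies n q).map _) ((genRight_satisfies n q).map _)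
    (fun x y => (genLeft_commute_genRight x y).map (outerAction ρ ρ)) ?_ ?_ ?_ ?_
  · have hsw : (TensorProduct.comm k (Fin ℓ → k) (Fin ℓ → k)).toLinearMap ∘ₗ
        (outerAction ρ ρ (genLeft n q .b) * outerAction ρ ρ (genRight n q .a) +
          outerAction ρ ρ (genLeft n q .a)) =
        outerAction ρ ρ (comulGen n q .a) ∘ₗ
          (TensorProduct.comm k (Fin ℓ → k) (Fin ℓ → k)).toLinearMap :=
      TensorProduct.ext' fun v w => by simp [comulGen_a, add_comm]
    rw [tensorModule_of, rCheck, outerAction_rMatrix]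
    have e : outerAction ρ ρ (comulGen n q .a) = outerAction ρ ρ (genLeft n q .a) *
        outerAction ρ ρ (genRight n q .b) + outerAction ρ ρ (genRight n q .a) := by
      simp [comulGen_a]
    rw [Module.End.mul_eq_comp, Module.End.mul_eq_comp, ← LinearMap.comp_assoc, ← hsw,
      LinearMap.comp_assoc, LinearMap.comp_assoc, e]
    exact congrArg _ key
  · refine stdVec_tmul_ext fun j _ j' _ => ?_
    simp only [Module.End.mul_apply, hρ, outerAction_rCartan, outerAction_genLeft,
      outerAction_genRight, map_smul, simpleModule_a, simpleModule_c, TensorProduct.tmul_smul,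
      smul_smul, cartanScalar_succ_left hq]
  · refine stdVec_tmul_ext fun j _ j' _ => ?_
    simp only [Module.End.mul_apply, hρ, outerAction_rCartan, outerAction_genLeft,
      outerAction_genRight, map_smul, simpleModule_a, simpleModule_b, ← TensorProduct.smul_tmul',
      smul_smul, cartanScalar_succ_right hq]
  · refine stdVec_tmul_ext fun j _ j' _ => ?_
    simp only [Module.End.mul_apply, hρ, outerAction_rCartan, outerAction_genRight,
      map_smul, simpleModule_b, TensorProduct.tmul_smul, smul_smul, mul_comm]
  · refine stdVec_tmul_ext fun j _ j' _ => ?_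
    simp only [Module.End.mul_apply, hρ, outerAction_rCartan, outerAction_genRight,
      map_smul, simpleModule_c, TensorProduct.tmul_smul, smul_smul, mul_comm]

omit [CharZero k] [NeZero n] in
lemma simpleModule_d_pow (j : ℕ) : ∃ c : ℕ → k, c 0 = 1 ∧ (∀ s, j < s → c s = 0) ∧
    ∀ s, (simpleModule hn hq hℓ r (D.of n q .d) ^ s) (stdVec k ℓ j)
      = c s • stdVec k ℓ (j - s) := by
  refine ⟨fun s => ∏ u ∈ Finset.range s, alpha q (j - u) ℓ, by simp, fun s hs => ?_, fun s => ?_⟩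
  · exact Finset.prod_eq_zero (Finset.mem_range.mpr hs) (by simp [alpha_zero])
  · induction s with
    | zero => simp
    | succ s ih =>
      rw [pow_succ', Module.End.mul_apply, ih]
      simp only [map_smul, simpleModule_d, smul_smul, Finset.prod_range_succ, Nat.sub_sub]

omit [CharZero k] [NeZero n] in
lemma simpleModule_a_pow (j s : ℕ) :
    (simpleModule hn hq hℓ r (D.of n q .a) ^ s) (stdVec k ℓ j) = stdVec k ℓ (j + s) := by
  induction s with
  | zero => simp
  | succ s ih => rw [pow_succ', Module.End.mul_apply, ih, simpleModule_a, add_assoc]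

/-- The factor a^s ⊗ d^s moves s units of degree from right to left before the flip. Later arguments
need only the leading coefficient and the vanishing for s > j', where j' - s is truncated. -/
lemma rCheck_stdVec (j j' : ℕ) : ∃ c : ℕ → k,
    c 0 = cartanScalar q ℓ r j j' ∧ (∀ s, j' < s → c s = 0) ∧
    rCheck (simpleModule hn hq hℓ r) (stdVec k ℓ j ⊗ₜ stdVec k ℓ j') =
      ∑ s ∈ Finset.range n, c s • (stdVec k ℓ (j' - s) ⊗ₜ[k] stdVec k ℓ (j + s)) := by
  obtain ⟨c, hc0, hc, hd⟩ := simpleModule_d_pow hn hq hℓ r j'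
  refine ⟨fun s => (qFact q s)⁻¹ * (c s * cartanScalar q ℓ r j (j' - s)), ?_, fun s hs => ?_, ?_⟩
  · simp [qFact, hc0]
  · simp [hc s hs]
  · set ρ := simpleModule hn hq hℓ r with hρ
    have hR : ∀ s v w, (outerAction ρ ρ (genRight n q .d) ^ s) (v ⊗ₜ w)
        = v ⊗ₜ (ρ (D.of n q .d) ^ s) w := by
      intro s v w
      induction s with
      | zero => simp
      | succ s ih => simp [pow_succ', ih]
    have hL : ∀ s v w, (outerAction ρ ρ (genLeft n q .a) ^ s) (v ⊗ₜ w)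
        = (ρ (D.of n q .a) ^ s) v ⊗ₜ w := by
      intro s v w
      induction s with
      | zero => simp
      | succ s ih => simp [pow_succ', ih]
    rw [rCheck, outerAction_rMatrix, rSum]
    simp only [LinearMap.comp_apply, LinearMap.sum_apply, LinearMap.smul_apply,
      Module.End.mul_apply, hR, hd, map_sum, map_smul, TensorProduct.tmul_smul]
    refine Finset.sum_congr rfl fun s _ => ?_
    rw [hρ, outerAction_rCartan, ← hρ, map_smul, hL, hρ, simpleModule_a_pow]
    simp [smul_smul]

end RCheck

/-! ### The grading of V ⊗ V and the kernel of d -/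

section Coordinates

variable {k : Type*} [Field k] {n : ℕ} [NeZero n] {q : k} {ℓ : ℕ}

/-- The coordinates of `V ⊗ V` with respect to the vectors `e_p ⊗ e_p'`, for all indices. -/
noncomputable def tensorCoord (k : Type*) [Field k] (ℓ p p' : ℕ) :
    (Fin ℓ → k) ⊗[k] (Fin ℓ → k) →ₗ[k] k :=
  if h : p < ℓ ∧ p' < ℓ then
    ((Pi.basisFun k (Fin ℓ)).tensorProduct (Pi.basisFun k (Fin ℓ))).coord (⟨p, h.1⟩, ⟨p', h.2⟩)
  else 0

lemma tensorCoord_stdVec (p p' j j' : ℕ) : tensorCoord k ℓ p p' (stdVec k ℓ j ⊗ₜ stdVec k ℓ j') =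
    if p < ℓ ∧ p' < ℓ ∧ j = p ∧ j' = p' then 1 else 0 := by
  unfold tensorCoord
  split_ifs with h1 h2 h2
  · obtain ⟨hp, hp', rfl, rfl⟩ := h2
    simp [stdVec_of_lt hp, stdVec_of_lt hp', Module.Basis.tensorProduct_repr_tmul_apply]
  · rcases lt_or_ge j ℓ with hj | hj
    · rcases lt_or_ge j' ℓ with hj' | hj'
      · rw [stdVec_of_lt hj, stdVec_of_lt hj']
        simp only [Module.Basis.coord_apply, Module.Basis.tensorProduct_repr_tmul_apply,
          Module.Basis.repr_self, Finsupp.single_apply, Fin.mk.injEq, smul_eq_mul]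
        have : ¬ (j = p ∧ j' = p') := fun h => h2 ⟨h1.1, h1.2, h⟩
        split_ifs <;> simp_all
      · rw [stdVec_of_le hj', TensorProduct.tmul_zero, map_zero]
    · rw [stdVec_of_le hj, TensorProduct.zero_tmul, map_zero]
  · exact absurd ⟨h2.1, h2.2.1⟩ h1
  · rfl

lemma eq_zero_of_tensorCoord {y : (Fin ℓ → k) ⊗[k] (Fin ℓ → k)}
    (h : ∀ p < ℓ, ∀ p' < ℓ, tensorCoord k ℓ p p' y = 0) : y = 0 := by
  refine Module.Basis.ext_elem ((Pi.basisFun k (Fin ℓ)).tensorProduct (Pi.basisFun k (Fin ℓ)))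
    fun ⟨p, p'⟩ => ?_
  have := h p p.isLt p' p'.isLt
  rw [tensorCoord, dif_pos ⟨p.isLt, p'.isLt⟩] at this
  rw [map_zero, Finsupp.zero_apply]
  exact this

/-- The homogeneous component of degree `N` of `V ⊗ V`. -/
noncomputable def homog (k : Type*) [Field k] (ℓ N : ℕ) :
    Submodule k ((Fin ℓ → k) ⊗[k] (Fin ℓ → k)) :=
  Submodule.span k {y | ∃ j j', j + j' = N ∧ y = stdVec k ℓ j ⊗ₜ stdVec k ℓ j'}

lemma stdVec_mem_homog {j j' N : ℕ} (h : j + j' = N) :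
    stdVec k ℓ j ⊗ₜ stdVec k ℓ j' ∈ homog k ℓ N :=
  Submodule.subset_span ⟨j, j', h, rfl⟩

lemma tensorCoord_homog {N p p' : ℕ} (h : p + p' ≠ N) {y : (Fin ℓ → k) ⊗[k] (Fin ℓ → k)}
    (hy : y ∈ homog k ℓ N) : tensorCoord k ℓ p p' y = 0 := by
  refine (Submodule.span_le (p := LinearMap.ker (tensorCoord k ℓ p p'))).mpr ?_ hy
  rintro _ ⟨j, j', hj, rfl⟩
  rw [SetLike.mem_coe, LinearMap.mem_ker, tensorCoord_stdVec, if_neg (by omega)]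

variable (hn : 2 ≤ n) (hq : IsPrimitiveRoot q n) (hℓ : ℓ ≤ n) (r : ZMod n)

/-- The action of the generators of `D_n` on `V(ℓ,r) ⊗ V(ℓ,r)`. -/
noncomputable abbrev squareGen (x : Gen) : Module.End k ((Fin ℓ → k) ⊗[k] (Fin ℓ → k)) :=
  tensorModule hq (simpleModule hn hq hℓ r) (simpleModule hn hq hℓ r) (D.of n q x)

lemma squareGen_satisfies : Satisfies n q (squareGen hn hq hℓ r) :=
  (D.satisfies n q).map _

lemma squareGen_a_homog {N : ℕ} {y : (Fin ℓ → k) ⊗[k] (Fin ℓ → k)} (hy : y ∈ homog k ℓ N) :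
    squareGen hn hq hℓ r .a y ∈ homog k ℓ (N + 1) := by
  refine (Submodule.span_le (p := (homog k ℓ (N + 1)).comap (squareGen hn hq hℓ r .a))).mpr ?_ hy
  rintro _ ⟨j, j', hj, rfl⟩
  rw [SetLike.mem_coe, Submodule.mem_comap, tensorSquare_a]
  exact add_mem (Submodule.smul_mem _ _ (stdVec_mem_homog (by omega)))
    (stdVec_mem_homog (by omega))

lemma squareGen_b_homog {N : ℕ} {y : (Fin ℓ → k) ⊗[k] (Fin ℓ → k)} (hy : y ∈ homog k ℓ N) :
    squareGen hn hq hℓ r .b y = q ^ (2 * (r.val : ℤ) + N) • y := by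
  refine (Submodule.span_le (p := LinearMap.eqLocus (squareGen hn hq hℓ r .b)
    (q ^ (2 * (r.val : ℤ) + N) • LinearMap.id))).mpr ?_ hy
  rintro _ ⟨j, j', rfl, rfl⟩
  exact tensorSquare_b _ _ _ _ _ _

lemma squareGen_c_homog {N : ℕ} {y : (Fin ℓ → k) ⊗[k] (Fin ℓ → k)} (hy : y ∈ homog k ℓ N) :
    squareGen hn hq hℓ r .c y = q ^ ((N : ℤ) + 2 - 2 * (r.val + ℓ)) • y := by
  refine (Submodule.span_le (p := LinearMap.eqLocus (squareGen hn hq hℓ r .c)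
    (q ^ ((N : ℤ) + 2 - 2 * (r.val + ℓ)) • LinearMap.id))).mpr ?_ hy
  rintro _ ⟨j, j', rfl, rfl⟩
  exact tensorSquare_c _ _ _ _ _ _

lemma rCheck_homog [CharZero k] {N : ℕ} {y : (Fin ℓ → k) ⊗[k] (Fin ℓ → k)}
    (hy : y ∈ homog k ℓ N) : rCheck (simpleModule hn hq hℓ r) y ∈ homog k ℓ N := by
  refine (Submodule.span_le
    (p := (homog k ℓ N).comap (rCheck (simpleModule hn hq hℓ r)))).mpr ?_ hy
  rintro _ ⟨j, j', hj, rfl⟩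
  obtain ⟨c, -, hc, h⟩ := rCheck_stdVec hn hq hℓ r j j'
  rw [SetLike.mem_coe, Submodule.mem_comap, h]
  refine Submodule.sum_mem _ fun s _ => ?_
  rcases le_or_gt s j' with hs | hs
  · exact Submodule.smul_mem _ _ (stdVec_mem_homog (by omega))
  · rw [hc s hs, zero_smul]
    exact zero_mem _

/-- Turns d y = 0 into a two-term recursion along each antidiagonal p + p' = const. -/
lemma tensorCoord_d {p p' : ℕ} (hp : p < ℓ) (hp' : p' < ℓ) (y : (Fin ℓ → k) ⊗[k] (Fin ℓ → k)) :
    tensorCoord k ℓ p p' (squareGen hn hq hℓ r .d y) =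
      alpha q (p + 1) ℓ * q ^ ((p' : ℤ) + 1 - (r.val + ℓ)) * tensorCoord k ℓ (p + 1) p' y +
        alpha q (p' + 1) ℓ * tensorCoord k ℓ p (p' + 1) y := by
  suffices tensorCoord k ℓ p p' ∘ₗ squareGen hn hq hℓ r .d =
      (alpha q (p + 1) ℓ * q ^ ((p' : ℤ) + 1 - (r.val + ℓ))) • tensorCoord k ℓ (p + 1) p' +
        alpha q (p' + 1) ℓ • tensorCoord k ℓ p (p' + 1) from LinearMap.congr_fun this y
  refine stdVec_tmul_ext fun j hj j' hj' => ?_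
  rw [LinearMap.comp_apply, tensorSquare_d]
  simp only [map_add, map_smul, LinearMap.add_apply, LinearMap.smul_apply, tensorCoord_stdVec,
    smul_eq_mul]
  congr 1
  · rcases j with _ | j
    · simp [alpha_zero]
    · by_cases h : j = p ∧ j' = p'
      · obtain ⟨rfl, rfl⟩ := h
        simp [hp, hp', hj]
      · rw [if_neg (by omega), if_neg (by omega)]; simp
  · rcases j' with _ | j'
    · simp [alpha_zero]
    · by_cases h : j = p ∧ j' = p'
      · obtain ⟨rfl, rfl⟩ := h
        simp [hp, hp', hj']
      · rw [if_neg (by omega), if_neg (by omega)]; simp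

lemma tensorCoord_of_ge {p p' : ℕ} (h : ℓ ≤ p ∨ ℓ ≤ p') (y : (Fin ℓ → k) ⊗[k] (Fin ℓ → k)) :
    tensorCoord k ℓ p p' y = 0 := by
  rw [tensorCoord, dif_neg (by omega)]; rfl

/-- Injectivity of d in degrees at least ℓ: such an antidiagonal reaches p = ℓ, where coordinates
vanish, and the recursion descends in p from there, dividing by α_p' ≠ 0. -/
lemma tensorCoord_eq_zero_of_d {y : (Fin ℓ → k) ⊗[k] (Fin ℓ → k)}
    (hy : squareGen hn hq hℓ r .d y = 0) {p p' : ℕ} (h : ℓ ≤ p + p') :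
    tensorCoord k ℓ p p' y = 0 := by
  -- t bounds the number of steps from p up to ℓ.
  obtain ⟨t, ht⟩ : ∃ t, p + t = ℓ ∨ ℓ ≤ p := ⟨ℓ - p, by omega⟩
  induction t generalizing p p' with
  | zero => exact tensorCoord_of_ge (by omega) y
  | succ t ih =>
    rcases lt_or_ge p ℓ with hp | hp
    swap
    · exact tensorCoord_of_ge (Or.inl hp) y
    rcases lt_or_ge p' ℓ with hp' | hp'
    swap
    · exact tensorCoord_of_ge (Or.inr hp') y
    obtain ⟨u, rfl⟩ : ∃ u, p' = u + 1 := ⟨p' - 1, by omega⟩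
    have h1 := tensorCoord_d hn hq hℓ r hp (show u < ℓ by omega) y
    rw [hy, map_zero, ih (p := p + 1) (p' := u) (by omega) (by omega), mul_zero, zero_add] at h1
    exact (mul_eq_zero.mp h1.symm).resolve_left (alpha_ne_zero hq (Nat.succ_pos u) hp' hℓ)

/-- In degree N < ℓ the antidiagonal starts inside the square at (0, N), and the recursion ascends
from there. So d has at most a line as kernel in this degree. -/
lemma eq_zero_of_d_of_homog {N : ℕ} (hN : N < ℓ) {y : (Fin ℓ → k) ⊗[k] (Fin ℓ → k)}
    (hy : squareGen hn hq hℓ r .d y = 0) (hyN : y ∈ homog k ℓ N)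
    (h0 : tensorCoord k ℓ 0 N y = 0) : y = 0 := by
  have hz : q ≠ 0 := hq.ne_zero (NeZero.ne n)
  have main : ∀ p p', p + p' = N → tensorCoord k ℓ p p' y = 0 := by
    intro p
    induction p with
    | zero => intro p' h; rw [show p' = N by omega]; exact h0
    | succ p ih =>
      intro p' h
      have h1 := tensorCoord_d hn hq hℓ r (show p < ℓ by omega) (show p' < ℓ by omega) y
      rw [hy, map_zero, ih (p' + 1) (by omega), mul_zero, add_zero] at h1
      exact (mul_eq_zero.mp h1.symm).resolve_left
        (mul_ne_zero (alpha_ne_zero hq (Nat.succ_pos p) (by omega) hℓ) (zpow_ne_zero _ hz))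
  refine eq_zero_of_tensorCoord fun p _ p' _ => ?_
  by_cases h : p + p' = N
  · exact main p p' h
  · exact tensorCoord_homog h hyN

end Coordinates

/-! ### Lowest weight vectors and the eigenvalues of `Ř` -/

section LowestWeightVectors

variable {k : Type*} [Field k] {n : ℕ} {q : k}

/-- The coefficients of the lowest weight vector of degree `i` in `V(ℓ,r) ⊗ V(ℓ,r)`. -/
noncomputable def lowestCoeff (q : k) (ℓ : ℕ) (r : ZMod n) (i : ℕ) : ℕ → k
  | 0 => 1
  | j + 1 => -(lowestCoeff q ℓ r i j * alpha q (i - j) ℓ *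
      q ^ ((r.val : ℤ) + ℓ + j - i)) / alpha q (j + 1) ℓ

/-- The lowest weight vector of degree `i` in `V(ℓ,r) ⊗ V(ℓ,r)`. -/
noncomputable def lowestVec (q : k) (ℓ : ℕ) (r : ZMod n) (i : ℕ) :
    (Fin ℓ → k) ⊗[k] (Fin ℓ → k) :=
  ∑ j ∈ Finset.range (i + 1),
    lowestCoeff q ℓ r i j • (stdVec k ℓ j ⊗ₜ stdVec k ℓ (i - j))

lemma lowestVec_mem_homog (ℓ : ℕ) (r : ZMod n) (i : ℕ) : lowestVec q ℓ r i ∈ homog k ℓ i :=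
  Submodule.sum_mem _ fun j hj => Submodule.smul_mem _ _
    (stdVec_mem_homog (by have := Finset.mem_range.mp hj; omega))

lemma tensorCoord_lowestVec {ℓ : ℕ} (r : ZMod n) {i p p' : ℕ} (hi : i < ℓ) (h : p + p' = i) :
    tensorCoord k ℓ p p' (lowestVec q ℓ r i) = lowestCoeff q ℓ r i p := by
  rw [lowestVec, map_sum, Finset.sum_eq_single p]
  · rw [map_smul, tensorCoord_stdVec, if_pos (by omega), smul_eq_mul, mul_one]
  · intro j _ hj
    rw [map_smul, tensorCoord_stdVec, if_neg (by omega), smul_zero]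
  · intro hp
    exact absurd (Finset.mem_range.mpr (by omega)) hp

lemma lowestCoeff_mul_prod (hq : IsPrimitiveRoot q n) {ℓ : ℕ} (hℓ : ℓ ≤ n) (r : ZMod n) {i : ℕ}
    (hi : i < ℓ) : ∀ j, j ≤ i →
      lowestCoeff q ℓ r i j * ∏ u ∈ Finset.range j, alpha q (u + 1) ℓ =
        (-1) ^ j * (∏ u ∈ Finset.range j, alpha q (i - u) ℓ) *
          ∏ u ∈ Finset.range j, q ^ ((r.val : ℤ) + ℓ + u - i)
  | 0, _ => by simp [lowestCoeff]
  | j + 1, hj => by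
    have ih := lowestCoeff_mul_prod hq hℓ r hi j (by omega)
    have hne := alpha_ne_zero hq (Nat.succ_pos j) (show j + 1 < ℓ by omega) hℓ
    simp only [Finset.prod_range_succ, lowestCoeff, pow_succ]
    field_simp
    linear_combination (-alpha q (i - j) ℓ * q ^ ((r.val : ℤ) + ℓ + j - i)) * ih

/-- The square avoids the exponent j(j-1)/2. -/
lemma sq_prod_zpow (h0 : q ≠ 0) (x : ℤ) (j : ℕ) :
    (∏ u ∈ Finset.range j, q ^ (x + u)) ^ 2 = q ^ (2 * j * x + j * (j - 1)) := by
  induction j with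
  | zero => simp
  | succ j ih =>
    rw [Finset.prod_range_succ, mul_pow, ih, ← zpow_natCast, ← zpow_mul, ← zpow_add₀ h0]
    congr 1
    push_cast
    ring

/-- For j = i the two products of α's agree after the reflection u ↦ i-1-u and cancel. A signed
power of q remains, and squaring removes the sign. -/
lemma lowestCoeff_self_sq (hq : IsPrimitiveRoot q n) {ℓ : ℕ} (hℓ : ℓ ≤ n) (r : ZMod n) {i : ℕ}
    (hi : i < ℓ) :
    lowestCoeff q ℓ r i i ^ 2 = q ^ (2 * (i : ℤ) * (r.val + ℓ) - i ^ 2 - i) := by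
  have h := lowestCoeff_mul_prod hq hℓ r hi i le_rfl
  have hrefl : ∏ u ∈ Finset.range i, alpha q (i - u) ℓ = ∏ u ∈ Finset.range i, alpha q (u + 1) ℓ := by
    rw [← Finset.prod_range_reflect]
    refine Finset.prod_congr rfl fun u hu => ?_
    have := Finset.mem_range.mp hu
    congr 1
    omega
  have hne : ∏ u ∈ Finset.range i, alpha q (u + 1) ℓ ≠ 0 :=
    Finset.prod_ne_zero_iff.mpr fun u hu => alpha_ne_zero hq (Nat.succ_pos u)
      (by have := Finset.mem_range.mp hu; omega) hℓ
  rw [hrefl, mul_right_comm] at h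
  rw [mul_right_cancel₀ hne h, mul_pow, ← pow_mul, mul_comm i 2, pow_mul, neg_one_sq, one_pow,
    one_mul]
  have e : ∀ u ∈ Finset.range i, q ^ ((r.val : ℤ) + ℓ + u - i) = q ^ ((r.val : ℤ) + ℓ - i + u) :=
    fun u _ => by congr 1; ring
  rw [Finset.prod_congr rfl e, sq_prod_zpow (hq.ne_zero (by omega))]
  congr 1
  ring

variable [NeZero n] (hn : 2 ≤ n) (hq : IsPrimitiveRoot q n) {ℓ : ℕ} (hℓ : ℓ ≤ n) (r : ZMod n)

lemma squareGen_d_lowestVec {i : ℕ} (hi : i < ℓ) :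
    squareGen hn hq hℓ r .d (lowestVec q ℓ r i) = 0 := by
  have h0 : q ≠ 0 := hq.ne_zero (NeZero.ne n)
  -- H j is the part of d on the j-th term that lowers the left factor; by the recursion for the
  -- coefficients, the part lowering the right factor is -H (j+1).
  let H : ℕ → (Fin ℓ → k) ⊗[k] (Fin ℓ → k) := fun j =>
    (lowestCoeff q ℓ r i j * (alpha q j ℓ * q ^ ((i : ℤ) - j + 1 - (r.val + ℓ)))) •
      (stdVec k ℓ (j - 1) ⊗ₜ[k] stdVec k ℓ (i - j))
  have key : ∀ j ∈ Finset.range (i + 1), squareGen hn hq hℓ r .d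
      (lowestCoeff q ℓ r i j • (stdVec k ℓ j ⊗ₜ stdVec k ℓ (i - j))) = H j - H (j + 1) := by
    intro j hj
    have hj := Finset.mem_range.mp hj
    rw [map_smul, tensorSquare_d, smul_add, sub_eq_add_neg (H j)]
    congr 1
    · rw [smul_smul, Nat.cast_sub (by omega)]
    · simp only [H, lowestCoeff, Nat.add_sub_cancel, ← Nat.sub_sub, smul_smul]
      rcases Nat.lt_or_ge j i with hji | hji
      · have hne := alpha_ne_zero hq (Nat.succ_pos j) (show j + 1 < ℓ by omega) hℓ
        have e : q ^ ((r.val : ℤ) + ℓ + j - i) * q ^ ((i : ℤ) - (j + 1 : ℕ) + 1 - (r.val + ℓ)) = 1 := by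
          rw [← zpow_add₀ h0]
          convert zpow_zero q using 2
          push_cast
          ring
        refine Eq.trans ?_ (neg_smul (M := (Fin ℓ → k) ⊗[k] (Fin ℓ → k)) _ _)
        congr 1
        field_simp
        linear_combination (-lowestCoeff q ℓ r i j * alpha q (i - j) ℓ) * e
      · simp [show i - j = 0 by omega, alpha_zero]
  rw [lowestVec, map_sum, Finset.sum_congr rfl key, Finset.sum_range_sub']
  have h1 : H 0 = 0 := by simp [H, alpha_zero]
  have h2 : H (i + 1) = 0 := by simp [H, lowestCoeff, alpha_zero]
  rw [h1, h2, sub_zero]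

/-- The eigenvalue of `Ř` on the submodule generated by the lowest weight vector of degree `i`. -/
noncomputable def rCheckEigenvalue (q : k) (ℓ : ℕ) (r : ZMod n) (i : ℕ) : k :=
  cartanScalar q ℓ r 0 i / lowestCoeff q ℓ r i i

include hn in
lemma rCheck_lowestVec [CharZero k] {i : ℕ} (hi : i < ℓ) :
    rCheck (simpleModule hn hq hℓ r) (lowestVec q ℓ r i) =
      rCheckEigenvalue q ℓ r i • lowestVec q ℓ r i := by
  set y := rCheck (simpleModule hn hq hℓ r) (lowestVec q ℓ r i) with hy
  have hd : squareGen hn hq hℓ r .d y = 0 := by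
    have := LinearMap.congr_fun (rCheck_comm_d hn hq hℓ r) (lowestVec q ℓ r i)
    rw [Module.End.mul_apply, Module.End.mul_apply, squareGen_d_lowestVec hn hq hℓ r hi,
      map_zero] at this
    exact this.symm
  have hyi : y ∈ homog k ℓ i := rCheck_homog hn hq hℓ r (lowestVec_mem_homog ℓ r i)
  -- Both vectors lie in the kernel of d in degree i, and the coefficient of e_0 ⊗ e_i in
  -- `lowestVec` is 1.
  have h1 : y - tensorCoord k ℓ 0 i y • lowestVec q ℓ r i = 0 := by
    refine eq_zero_of_d_of_homog hn hq hℓ r hi ?_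
      (sub_mem hyi (Submodule.smul_mem _ _ (lowestVec_mem_homog ℓ r i))) ?_
    · rw [map_sub, map_smul, hd, squareGen_d_lowestVec hn hq hℓ r hi, smul_zero, sub_zero]
    · rw [map_sub, map_smul, tensorCoord_lowestVec r hi (by omega)]
      simp [lowestCoeff]
  -- The image of e_j ⊗ e_(i-j) involves the vectors e_(i-j-s) ⊗ e_(j+s), so e_i ⊗ e_0 forces j = s
  -- = 0.
  have h2 : tensorCoord k ℓ i 0 y = cartanScalar q ℓ r 0 i := by
    rw [hy, lowestVec, map_sum, map_sum, Finset.sum_eq_single 0]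
    · obtain ⟨c, hc0, -, h⟩ := rCheck_stdVec hn hq hℓ r 0 i
      rw [map_smul, Nat.sub_zero, h, map_smul, map_sum, Finset.sum_eq_single 0]
      · rw [map_smul, tensorCoord_stdVec, if_pos (by omega), hc0]
        simp [lowestCoeff]
      · intro s _ hs
        rw [map_smul, tensorCoord_stdVec, if_neg (by omega), smul_zero]
      · intro h
        exact absurd (Finset.mem_range.mpr (NeZero.pos n)) h
    · intro j _ hj
      obtain ⟨c, -, -, h⟩ := rCheck_stdVec hn hq hℓ r j (i - j)
      rw [map_smul, map_smul, h, map_sum, Finset.sum_eq_zero, smul_zero]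
      intro s _
      rw [map_smul, tensorCoord_stdVec, if_neg (by omega), smul_zero]
    · intro h
      exact absurd (Finset.mem_range.mpr (Nat.succ_pos i)) h
  have h3 : lowestCoeff q ℓ r i i ≠ 0 := by
    intro h
    have := lowestCoeff_self_sq hq hℓ r hi
    rw [h] at this
    exact zpow_ne_zero _ (hq.ne_zero (NeZero.ne n)) (by rw [← this]; simp)
  have h4 : tensorCoord k ℓ 0 i y = rCheckEigenvalue q ℓ r i := by
    rw [rCheckEigenvalue, eq_div_iff h3, ← h2]
    conv_rhs => rw [sub_eq_zero.mp h1]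
    rw [map_smul, tensorCoord_lowestVec r hi (by omega), smul_eq_mul]
  rw [← h4]
  exact sub_eq_zero.mp h1

omit [NeZero n] in
lemma zpow_eq_of_dvd_sub (hq : IsPrimitiveRoot q n) (h0 : q ≠ 0) {x y : ℤ}
    (h : (n : ℤ) ∣ x - y) : q ^ x = q ^ y := by
  rw [← sub_add_cancel x y, zpow_add₀ h0, (hq.zpow_eq_one_iff_dvd _).mpr h, one_mul]

lemma exists_val_eq (r : ZMod n) (i : ℕ) :
    ∃ t : ℤ, ((2 * r + i : ZMod n).val : ℤ) = 2 * r.val + i + n * t := by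
  have h : (((2 * r + i : ZMod n).val : ℤ) : ZMod n) = ((2 * r.val + i : ℤ) : ZMod n) := by
    push_cast
    simp
  rw [ZMod.intCast_eq_intCast_iff_dvd_sub] at h
  obtain ⟨t, ht⟩ := h
  exact ⟨-t, by linear_combination -ht⟩

include hq hℓ in
-- The exponents agree modulo n. Here a - 1 = 2(ℓ-1-i), so for odd n the term -(n-1)(a-1)/2 is
-- congruent to ℓ-1-i.
lemma rCheckEigenvalue_sq (hodd : Odd n) {i : ℕ} (hi : i < ℓ) :
    rCheckEigenvalue q ℓ r i ^ 2 = cScalar q ℓ r (2 * ℓ - 1 - 2 * i, 2 * r + i) := by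
  have h0 : q ≠ 0 := hq.ne_zero (NeZero.ne n)
  rw [rCheckEigenvalue, div_pow, lowestCoeff_self_sq hq hℓ r hi, cartanScalar, ← zpow_natCast,
    ← zpow_mul, ← zpow_sub₀ h0, cScalar]
  refine zpow_eq_of_dvd_sub hq h0 ?_
  obtain ⟨t, ht⟩ := exists_val_eq r i
  obtain ⟨h, hh⟩ := hodd
  have hA : ((2 * ℓ - 1 - 2 * i : ℕ) : ℤ) = 2 * ℓ - 1 - 2 * i := by omega
  have hhalf : ((n : ℤ) - 1) / 2 = h := by omega
  have hnh : (n : ℤ) = 2 * h + 1 := by exact_mod_cast hh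
  simp only [hA, ht, hhalf]
  -- The first summand is the effect of the representative 2r + i + nt of b on b(a+b-1); the second
  -- comes from (1 + (n-1))(ℓ-1-i).
  refine ⟨t * (2 * (2 * r.val + i) + n * t + (2 * ℓ - 1 - 2 * i) - 1) + (ℓ - 1 - i), ?_⟩
  push_cast
  linear_combination (-(ℓ : ℤ) + 1 + i) * hnh

end LowestWeightVectors

/-! ### Maps from V(A,s) and the kernel of d -/

section Submodules

variable {k : Type*} [Field k] {n : ℕ} {q : k}

lemma intertwines_of_gen {U W : Type*} [AddCommGroup U] [Module k U] [AddCommGroup W]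
    [Module k W] {ρ : D n q →ₐ[k] Module.End k U} {τ : D n q →ₐ[k] Module.End k W}
    {f : U →ₗ[k] W} (h : ∀ g, f ∘ₗ ρ (D.of n q g) = τ (D.of n q g) ∘ₗ f) (x : D n q) :
    f ∘ₗ ρ x = τ x ∘ₗ f := by
  obtain ⟨x, rfl⟩ := RingQuot.mkAlgHom_surjective k (Rel n q) x
  induction x using FreeAlgebra.induction with
  | grade0 c =>
    rw [AlgHom.commutes, AlgHom.commutes, AlgHom.commutes]
    ext v
    simp [Algebra.algebraMap_eq_smul_one]
  | grade1 g => exact h g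
  | mul x y hx hy =>
    rw [map_mul, map_mul, map_mul, Module.End.mul_eq_comp, Module.End.mul_eq_comp,
      ← LinearMap.comp_assoc, hx, LinearMap.comp_assoc, hy, LinearMap.comp_assoc]
  | add x y hx hy =>
    rw [map_add, map_add, map_add, LinearMap.comp_add, LinearMap.add_comp, hx, hy]

/-- On a vector w killed by d with bc-weight q^(1-A), the factor [j+1](1 - q^j bc) becomes
α_(j+1)(A), so d acts on the string a^j w as on V(A,s). -/
lemma Satisfies.d_mul_a_pow_apply {W : Type*} [AddCommGroup W] [Module k W]
    {f : Gen → Module.End k W} (hf : Satisfies n q f) (h1 : q ≠ 1) {w : W} {A : ℕ}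
    (hd : f .d w = 0) (hbc : f .b (f .c w) = q ^ (1 - (A : ℤ)) • w) (h0 : q ≠ 0) (j : ℕ) :
    f .d ((f .a ^ (j + 1)) w) = alpha q (j + 1) A • (f .a ^ j) w := by
  have h := LinearMap.congr_fun (hf.d_mul_a_pow j) w
  simp only [Module.End.mul_apply, LinearMap.add_apply, LinearMap.smul_apply, hd, map_zero,
    smul_zero, zero_add, LinearMap.sub_apply, Module.End.one_apply, hbc, map_sub, map_smul] at h
  have e : (f .a ^ j) w - q ^ j • q ^ (1 - (A : ℤ)) • (f .a ^ j) w =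
      (1 - q ^ j * q ^ (1 - (A : ℤ))) • (f .a ^ j) w := by
    rw [sub_smul, one_smul, mul_smul]
  rw [h, e, smul_smul]
  congr 1
  have h2 : q - 1 ≠ 0 := sub_ne_zero.mpr h1
  have h3 : qInt q (j + 1) * (q - 1) = q ^ (j + 1) - 1 := geom_sum_mul q (j + 1)
  rw [alpha, ← h3, ← zpow_natCast q j, ← zpow_add₀ h0]
  field_simp
  congr 3
  push_cast
  ring

/-- The linear map `V(A,s) → W`, `v_j ↦ a^(j-1) w`, given by a vector `w` of a `D_n`-module `W`. -/
noncomputable def lowestMap {W : Type*} [AddCommGroup W] [Module k W] (T : Module.End k W) (w : W)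
    (A : ℕ) : (Fin A → k) →ₗ[k] W :=
  (Pi.basisFun k (Fin A)).constr k fun j => (T ^ (j : ℕ)) w

lemma lowestMap_stdVec {W : Type*} [AddCommGroup W] [Module k W] {T : Module.End k W} {w : W}
    {A j : ℕ} (hj : j < A) : lowestMap T w A (stdVec k A j) = (T ^ j) w := by
  rw [stdVec_of_lt hj]
  exact Module.Basis.constr_basis _ _ _ _

/-- A lowest weight vector with the weights of V(A,s) and killed by a^A determines the whole action:
b and c q-commute past powers of a, and d is given by `d_mul_a_pow_apply`. -/
lemma lowestMap_intertwines {W : Type*} [AddCommGroup W] [Module k W]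
    (hn : 2 ≤ n) (hq : IsPrimitiveRoot q n) {A : ℕ} (hA : A ≤ n) (s : ZMod n)
    (τ : D n q →ₐ[k] Module.End k W) {w : W} (hd : τ (D.of n q .d) w = 0)
    (hb : τ (D.of n q .b) w = q ^ (s.val : ℤ) • w)
    (hc : τ (D.of n q .c) w = q ^ (1 - ((s.val : ℤ) + A)) • w)
    (ha : (τ (D.of n q .a) ^ A) w = 0) (x : D n q) :
    lowestMap (τ (D.of n q .a)) w A ∘ₗ simpleModule hn hq hA s x =
      τ x ∘ₗ lowestMap (τ (D.of n q .a)) w A := by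
  have h0 : q ≠ 0 := hq.ne_zero (by omega)
  have hτ : Satisfies n q (fun g => τ (D.of n q g)) := (D.satisfies n q).map τ
  refine intertwines_of_gen (fun g => stdVec_ext fun j hj => ?_) x
  rw [LinearMap.comp_apply, LinearMap.comp_apply, lowestMap_stdVec hj]
  cases g with
  | a =>
    rw [simpleModule_a, ← Module.End.mul_apply, ← pow_succ']
    rcases Nat.lt_or_ge (j + 1) A with h | h
    · rw [lowestMap_stdVec h]
    · rw [stdVec_of_le h, map_zero, show j + 1 = A by omega, ha]
  | b =>
    have e := LinearMap.congr_fun (mul_pow_of_qcomm hτ.ba j) w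
    simp only [Module.End.mul_apply, LinearMap.smul_apply, hb, map_smul, smul_smul] at e
    rw [simpleModule_b, map_smul, lowestMap_stdVec hj, e, zpow_add₀ h0, zpow_natCast q j,
      mul_comm]
  | c =>
    have e := LinearMap.congr_fun (mul_pow_of_qcomm hτ.ca j) w
    simp only [Module.End.mul_apply, LinearMap.smul_apply, hc, map_smul, smul_smul] at e
    rw [simpleModule_c, map_smul, lowestMap_stdVec hj, e, ← zpow_natCast q j, ← zpow_add₀ h0,
      add_sub_assoc]
  | d =>
    rw [simpleModule_d, map_smul]
    rcases j with _ | j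
    · rw [alpha_zero, zero_smul, pow_zero, Module.End.one_apply, hd]
    · rw [Nat.add_sub_cancel, lowestMap_stdVec (by omega)]
      refine (hτ.d_mul_a_pow_apply (hq.ne_one (by omega)) hd ?_ h0 j).symm
      simp only [hc, hb, map_smul, smul_smul]
      rw [← zpow_add₀ h0]
      congr 2
      ring

lemma simpleModule_d_ker (hn : 2 ≤ n) (hq : IsPrimitiveRoot q n) {A : ℕ} (hA : A ≤ n)
    (s : ZMod n) {u : Fin A → k} (hu : simpleModule hn hq hA s (D.of n q .d) u = 0) :
    ∃ y : k, u = y • stdVec k A 0 := by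
  have hcoord : ∀ (j : ℕ) (hj : j < A) (hj' : j + 1 < A), u ⟨j + 1, hj'⟩ = 0 := by
    intro j hj hj'
    have h1 : (LinearMap.proj ⟨j, hj⟩ ∘ₗ simpleModule hn hq hA s (D.of n q .d) :
        (Fin A → k) →ₗ[k] k) = alpha q (j + 1) A • LinearMap.proj ⟨j + 1, hj'⟩ := by
      refine stdVec_ext fun i hi => ?_
      rw [LinearMap.comp_apply, simpleModule_d]
      rcases i with _ | i
      · simp [alpha_zero, stdVec_of_lt hi, Pi.basisFun_apply]
      · simp only [Nat.add_sub_cancel, stdVec_of_lt hi, stdVec_of_lt (show i < A by omega),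
          Pi.basisFun_apply, map_smul, LinearMap.smul_apply, LinearMap.proj_apply,
          Pi.single_apply, Fin.mk.injEq, Nat.add_right_cancel_iff]
        by_cases h : j = i
        · subst h; simp
        · simp [h]
    have h2 := LinearMap.congr_fun h1 u
    rw [LinearMap.comp_apply, hu, map_zero, LinearMap.smul_apply, smul_eq_mul] at h2
    exact (mul_eq_zero.mp h2.symm).resolve_left (alpha_ne_zero hq (Nat.succ_pos j) hj' hA)
  rcases Nat.eq_zero_or_pos A with rfl | hpos
  · exact ⟨0, Subsingleton.elim _ _⟩
  · refine ⟨u ⟨0, hpos⟩, funext fun ⟨j, hj⟩ => ?_⟩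
    rcases j with _ | j
    · simp [stdVec_of_lt hpos]
    · rw [hcoord j (by omega) hj]
      simp [stdVec_of_lt hpos]

/-- A nonzero stable subspace on which T is nilpotent contains a nonzero vector killed by T. This
reduces injectivity of a D_n-map to vectors killed by d. -/
lemma eq_zero_of_pow_eq_zero {U : Type*} [AddCommGroup U] [Module k U] {T : Module.End k U}
    {S : Submodule k U} (hS : ∀ u ∈ S, T u ∈ S) (h : ∀ u ∈ S, T u = 0 → u = 0) :
    ∀ (m : ℕ), ∀ u ∈ S, (T ^ m) u = 0 → u = 0
  | 0, u, _, hu => by simpa using hu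
  | m + 1, u, hm, hu => h u hm <| eq_zero_of_pow_eq_zero hS h m (T u) (hS u hm) <| by
      rwa [← Module.End.mul_apply, ← pow_succ]

end Submodules

/-! ### Decomposition of V ⊗ V and the polynomial annihilating `Ř` -/

section Decomposition

variable {k : Type*} [Field k] {n : ℕ} [NeZero n] {q : k}
  (hn : 2 ≤ n) (hq : IsPrimitiveRoot q n) {ℓ : ℕ} (hℓ : ℓ ≤ n) (hℓ2 : 2 * ℓ ≤ n + 1) (r : ZMod n)

lemma squareGen_a_pow_homog (i j : ℕ) :
    (squareGen hn hq hℓ r .a ^ j) (lowestVec q ℓ r i) ∈ homog k ℓ (i + j) := by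
  induction j with
  | zero => exact lowestVec_mem_homog ℓ r i
  | succ j ih =>
    rw [pow_succ', Module.End.mul_apply, ← add_assoc]
    exact squareGen_a_homog hn hq hℓ r ih

lemma squareGen_a_pow_lowestVec {i : ℕ} (hi : i < ℓ) :
    (squareGen hn hq hℓ r .a ^ (2 * ℓ - 1 - 2 * i)) (lowestVec q ℓ r i) = 0 := by
  have h0 : q ≠ 0 := hq.ne_zero (NeZero.ne n)
  obtain ⟨B, hB⟩ : ∃ B, 2 * ℓ - 1 - 2 * i = B + 1 := ⟨2 * ℓ - 2 - 2 * i, by omega⟩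
  have hmem := squareGen_a_pow_homog hn hq hℓ r i (B + 1)
  -- The bc-weight of the vector is q^(2i+2-2ℓ) = q^(1-A) with A = B + 1, so d kills a^A of it
  -- because α_A(A) = 0.
  have hd := (squareGen_satisfies hn hq hℓ r).d_mul_a_pow_apply (hq.ne_one (by omega))
    (w := lowestVec q ℓ r i) (A := B + 1) (squareGen_d_lowestVec hn hq hℓ r hi) (by
      rw [squareGen_c_homog hn hq hℓ r (lowestVec_mem_homog ℓ r i), map_smul,
        squareGen_b_homog hn hq hℓ r (lowestVec_mem_homog ℓ r i), smul_smul, ← zpow_add₀ h0]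
      congr 2
      push_cast
      omega) h0 B
  rw [alpha_self, zero_smul] at hd
  rw [hB]
  refine eq_zero_of_tensorCoord fun p _ p' _ => ?_
  by_cases h : p + p' = i + (B + 1)
  -- The degree is 2ℓ-1-i, which is at least ℓ.
  · exact tensorCoord_eq_zero_of_d hn hq hℓ r hd (by omega)
  · exact tensorCoord_homog h hmem

omit [NeZero n] in
include hℓ2 in
lemma summand_dim_le (i : ℕ) : 2 * ℓ - 1 - 2 * i ≤ n := by omega

/-- The embedding of `V(2ℓ-1-2i, 2r+i)` into `V(ℓ,r) ⊗ V(ℓ,r)`. -/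
noncomputable def summandMap (i : ℕ) :
    (Fin (2 * ℓ - 1 - 2 * i) → k) →ₗ[k] (Fin ℓ → k) ⊗[k] (Fin ℓ → k) :=
  lowestMap (squareGen hn hq hℓ r .a) (lowestVec q ℓ r i) (2 * ℓ - 1 - 2 * i)

lemma summandMap_intertwines {i : ℕ} (hi : i < ℓ) (x : D n q) :
    summandMap hn hq hℓ r i ∘ₗ
        simpleModule hn hq (summand_dim_le hℓ2 i) (2 * r + i : ZMod n) x =
      tensorModule hq (simpleModule hn hq hℓ r) (simpleModule hn hq hℓ r) x ∘ₗ
        summandMap hn hq hℓ r i := by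
  have h0 : q ≠ 0 := hq.ne_zero (NeZero.ne n)
  obtain ⟨t, ht⟩ := exists_val_eq r i
  refine lowestMap_intertwines hn hq (summand_dim_le hℓ2 i) _ _
    (squareGen_d_lowestVec hn hq hℓ r hi) ?_ ?_ (squareGen_a_pow_lowestVec hn hq hℓ r hi) x
  · refine (squareGen_b_homog hn hq hℓ r (lowestVec_mem_homog ℓ r i)).trans ?_
    exact congrArg (· • lowestVec q ℓ r i)
      (zpow_eq_of_dvd_sub hq h0 ⟨-t, by rw [ht]; ring⟩)
  · refine (squareGen_c_homog hn hq hℓ r (lowestVec_mem_homog ℓ r i)).trans ?_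
    have hA : ((2 * ℓ - 1 - 2 * i : ℕ) : ℤ) = 2 * ℓ - 1 - 2 * i := by omega
    exact congrArg (· • lowestVec q ℓ r i)
      (zpow_eq_of_dvd_sub hq h0 ⟨t, by rw [ht, hA]; ring⟩)

/-- The sum of the embeddings `V(2ℓ-1-2i, 2r+i) → V(ℓ,r) ⊗ V(ℓ,r)`, `0 ≤ i < ℓ`. -/
noncomputable def squareMap :
    ((i : Fin ℓ) → Fin (2 * ℓ - 1 - 2 * i) → k) →ₗ[k] (Fin ℓ → k) ⊗[k] (Fin ℓ → k) :=
  ∑ i : Fin ℓ, summandMap hn hq hℓ r i ∘ₗ LinearMap.proj i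

/-- The action of `D_n` on the sum of the modules `V(2ℓ-1-2i, 2r+i)`. -/
noncomputable def summandsAction (x : D n q) :
    Module.End k ((i : Fin ℓ) → Fin (2 * ℓ - 1 - 2 * i) → k) :=
  LinearMap.pi fun i => simpleModule hn hq (summand_dim_le hℓ2 i)
    (2 * r + ((i : ℕ) : ZMod n)) x ∘ₗ LinearMap.proj i

lemma squareMap_intertwines (x : D n q) :
    squareMap hn hq hℓ r ∘ₗ summandsAction hn hq hℓ2 r x =
      tensorModule hq (simpleModule hn hq hℓ r) (simpleModule hn hq hℓ r) x ∘ₗ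
        squareMap hn hq hℓ r := by
  refine LinearMap.ext fun u => ?_
  simp only [squareMap, LinearMap.comp_apply, LinearMap.sum_apply, map_sum]
  exact Finset.sum_congr rfl fun i _ =>
    LinearMap.congr_fun (summandMap_intertwines hn hq hℓ hℓ2 r i.isLt x) (u i)

include hℓ2 in
-- The kernel is stable under the nilpotent d, so it suffices to treat its vectors killed by d.
-- Those are combinations of the generators of the summands, and their images have distinct degrees.
lemma squareMap_injective : Function.Injective (squareMap hn hq hℓ r) := by
  refine LinearMap.ker_eq_bot.mp ((Submodule.eq_bot_iff _).mpr fun u hu => ?_)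
  refine eq_zero_of_pow_eq_zero (T := summandsAction hn hq hℓ2 r (D.of n q .d)) ?_ ?_ n u hu ?_
  · intro u hu
    have := LinearMap.congr_fun (squareMap_intertwines hn hq hℓ hℓ2 r (D.of n q .d)) u
    rw [LinearMap.mem_ker] at hu ⊢
    rw [LinearMap.comp_apply, LinearMap.comp_apply, hu, map_zero] at this
    exact this
  · intro u hu hd
    choose y hy using fun i : Fin ℓ => simpleModule_d_ker hn hq (summand_dim_le hℓ2 i)
      (2 * r + ((i : ℕ) : ZMod n)) (u := u i) (congrFun hd i)
    have hsum : ∑ i : Fin ℓ, y i • lowestVec q ℓ r i = 0 := by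
      rw [← LinearMap.mem_ker.mp hu, squareMap, LinearMap.sum_apply]
      refine Finset.sum_congr rfl fun i _ => ?_
      rw [LinearMap.comp_apply, LinearMap.proj_apply, hy i, map_smul, summandMap,
        lowestMap_stdVec (by omega), pow_zero, Module.End.one_apply]
    funext i
    -- Only the vector of degree i has a coordinate at (0, i), and there it is 1.
    have hi := congrArg (tensorCoord k ℓ 0 i) hsum
    rw [map_zero, map_sum, Finset.sum_eq_single i, map_smul,
      tensorCoord_lowestVec r i.isLt (by omega)] at hi
    · rw [hy i]
      simp only [lowestCoeff, smul_eq_mul, mul_one] at hi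
      rw [hi, zero_smul, Pi.zero_apply]
    · intro j _ hj
      rw [map_smul, tensorCoord_homog _ (lowestVec_mem_homog ℓ r j), smul_zero]
      intro h
      exact hj (Fin.ext (by omega))
    · intro h
      exact absurd (Finset.mem_univ i) h
  · have hpow : ∀ (m : ℕ) (u) (i : Fin ℓ), (summandsAction hn hq hℓ2 r (D.of n q .d) ^ m) u i =
        (simpleModule hn hq (summand_dim_le hℓ2 i) (2 * r + ((i : ℕ) : ZMod n))
          (D.of n q .d) ^ m) (u i) := by
      intro m
      induction m with
      | zero => intro u i; rfl
      | succ m ih =>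
        intro u i
        rw [pow_succ, Module.End.mul_apply, ih, pow_succ, Module.End.mul_apply]
        rfl
    funext i
    rw [hpow, ← map_pow, (D.satisfies n q).d_pow, map_zero]
    rfl

lemma sum_summand_dims (ℓ : ℕ) : ∑ i : Fin ℓ, (2 * ℓ - 1 - 2 * (i : ℕ)) = ℓ * ℓ := by
  rw [Fin.sum_univ_eq_sum_range (fun i => 2 * ℓ - 1 - 2 * i)]
  have e : ∀ i ∈ Finset.range ℓ, 2 * ℓ - 1 - 2 * i = 2 * (ℓ - 1 - i) + 1 := by
    intro i hi
    have := Finset.mem_range.mp hi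
    omega
  rw [Finset.sum_congr rfl e, Finset.sum_range_reflect (fun i => 2 * i + 1) ℓ]
  induction ℓ with
  | zero => rfl
  | succ ℓ ih =>
    rw [Finset.sum_range_succ, ih fun i hi => by have := Finset.mem_range.mp hi; omega]
    ring

include hℓ2 in
-- The dimensions 2ℓ-1-2i are the first ℓ odd numbers, with sum ℓ² = dim V ⊗ V.
lemma squareMap_surjective : Function.Surjective (squareMap hn hq hℓ r) := by
  refine (LinearMap.injective_iff_surjective_of_finrank_eq_finrank ?_).mp
    (squareMap_injective hn hq hℓ hℓ2 r)
  rw [Module.finrank_pi_fintype, Module.finrank_tensorProduct]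
  simp [sum_summand_dims]

lemma isSummand_square {i : ℕ} (hi : i < ℓ) :
    IsSummand (simpleModule hn hq (summand_dim_le hℓ2 i) (2 * r + i : ZMod n))
      (tensorModule hq (simpleModule hn hq hℓ r) (simpleModule hn hq hℓ r)) := by
  let e := LinearEquiv.ofBijective (squareMap hn hq hℓ r)
    ⟨squareMap_injective hn hq hℓ hℓ2 r, squareMap_surjective hn hq hℓ hℓ2 r⟩
  have he : ∀ u, e u = squareMap hn hq hℓ r u := fun _ => rfl
  refine ⟨summandMap hn hq hℓ r i, LinearMap.proj (⟨i, hi⟩ : Fin ℓ) ∘ₗ e.symm.toLinearMap,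
    fun x => summandMap_intertwines hn hq hℓ hℓ2 r hi x, fun x => LinearMap.ext fun y => ?_,
    LinearMap.ext fun u => ?_⟩
  · obtain ⟨u, rfl⟩ := e.surjective y
    have h := LinearMap.congr_fun (squareMap_intertwines hn hq hℓ hℓ2 r x) u
    rw [LinearMap.comp_apply, LinearMap.comp_apply, ← he, ← he] at h
    simp only [LinearMap.comp_apply, LinearEquiv.coe_coe, ← h, LinearEquiv.symm_apply_apply]
    rfl
  · have h : summandMap hn hq hℓ r i u = e (Pi.single (⟨i, hi⟩ : Fin ℓ) u) := by
      rw [he, squareMap, LinearMap.sum_apply, Finset.sum_eq_single (⟨i, hi⟩ : Fin ℓ)]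
      · simp
      · intro j _ hj
        simp [hj]
      · intro h
        exact absurd (Finset.mem_univ _) h
    simp [h]

include hℓ2 in
lemma mem_squareSummands {i : ℕ} (hi : i < ℓ) :
    (2 * ℓ - 1 - 2 * i, 2 * r + (i : ZMod n)) ∈ squareSummands hn hq hℓ r := by
  classical
  refine Finset.mem_filter.mpr ⟨?_, summand_dim_le hℓ2 i, isSummand_square hn hq hℓ hℓ2 r hi⟩
  rw [Finset.mem_product]
  refine ⟨Finset.mem_Icc.mpr ⟨?_, summand_dim_le hℓ2 i⟩, Finset.mem_univ _⟩
  show 1 ≤ 2 * ℓ - 1 - 2 * i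
  omega

variable [CharZero k]

/-- Commutation with a spreads the eigenvalue from the lowest weight vector to the module it
generates. -/
lemma rCheck_summandMap {i : ℕ} (hi : i < ℓ) (u : Fin (2 * ℓ - 1 - 2 * i) → k) :
    rCheck (simpleModule hn hq hℓ r) (summandMap hn hq hℓ r i u) =
      rCheckEigenvalue q ℓ r i • summandMap hn hq hℓ r i u := by
  suffices rCheck (simpleModule hn hq hℓ r) ∘ₗ summandMap hn hq hℓ r i =
    rCheckEigenvalue q ℓ r i • summandMap hn hq hℓ r i from LinearMap.congr_fun this u
  refine stdVec_ext fun j hj => ?_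
  rw [LinearMap.comp_apply, LinearMap.smul_apply, summandMap, lowestMap_stdVec hj,
    ← Module.End.mul_apply]
  have h : Commute (rCheck (simpleModule hn hq hℓ r)) (squareGen hn hq hℓ r .a) :=
    rCheck_comm_a hn hq hℓ r
  rw [(h.pow_right j).eq, Module.End.mul_apply, rCheck_lowestVec hn hq hℓ r hi, map_smul]

include hℓ2 in
-- On the i-th summand the polynomial acts by its value at λ_i, which vanishes through the factor of
-- V(2ℓ-1-2i, 2r+i).
lemma aeval_rCheck (hodd : Odd n) :
    Polynomial.aeval (rCheck (simpleModule hn hq hℓ r))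
      (∏ U ∈ squareSummands hn hq hℓ r,
        (Polynomial.X ^ 2 - Polynomial.C (cScalar q ℓ r U))) = 0 := by
  refine LinearMap.ext fun y => ?_
  obtain ⟨u, rfl⟩ := squareMap_surjective hn hq hℓ hℓ2 r y
  rw [LinearMap.zero_apply, squareMap, LinearMap.sum_apply, map_sum]
  refine Finset.sum_eq_zero fun i _ => ?_
  rw [LinearMap.comp_apply,
    Module.End.aeval_apply_of_mem_apply_eq_smul (rCheck_summandMap hn hq hℓ r i.isLt _),
    Polynomial.eval_prod, Finset.prod_eq_zero (mem_squareSummands hn hq hℓ hℓ2 r i.isLt),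
    zero_smul]
  simp [rCheckEigenvalue_sq hq hℓ r hodd i.isLt]

end Decomposition

/-! ### Passage to tensor powers -/

section TensorPowers

variable {k : Type*} [Field k] {V : Type*} [AddCommGroup V] [Module k V]

/-- `atSlots` as a homomorphism of algebras. -/
noncomputable def atSlotsHom {m i : ℕ} (h1 : 1 ≤ i) (h2 : i + 1 ≤ m) :
    Module.End k (V ⊗[k] V) →ₐ[k] Module.End k (⨂[k]^m V) :=
  ((splitSlots k V h1 h2).conjAlgEquiv k).toAlgHom.comp
    ((Module.End.rTensorAlgHom k ((⨂[k]^(i - 1) V) ⊗[k] (V ⊗[k] V))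
      (⨂[k]^(m - i - 1) V)).comp
        (Module.End.lTensorAlgHom k (V ⊗[k] V) (⨂[k]^(i - 1) V)))

lemma atSlotsHom_apply {m i : ℕ} (h1 : 1 ≤ i) (h2 : i + 1 ≤ m) (T : Module.End k (V ⊗[k] V)) :
    atSlotsHom h1 h2 T = atSlots h1 h2 T := rfl

lemma eval_eq_zero_of_hasEigenvalue {T : Module.End k V} {p : Polynomial k}
    (hp : Polynomial.aeval T p = 0) {μ : k} (hμ : T.HasEigenvalue μ) : p.eval μ = 0 := by
  obtain ⟨v, hv⟩ := hμ.exists_hasEigenvector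
  have h := Module.End.aeval_apply_of_hasEigenvector (p := p) hv
  rw [hp, LinearMap.zero_apply] at h
  exact (smul_eq_zero.mp h.symm).resolve_right hv.2

end TensorPowers

end TaftDouble

theorem proposition4p4 {k : Type*} [Field k] [IsAlgClosed k] [CharZero k]
    {n : ℕ} [NeZero n] (hn2 : 2 ≤ n) (hn : 3 ≤ n) (hodd : Odd n)
    {q : k} (hq : IsPrimitiveRoot q n)
    {ℓ : ℕ} (hℓ1 : 1 ≤ ℓ) (hℓn : ℓ ≤ n) (hℓ : 2 * ℓ ≤ n + 1) (r : ZMod n)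
    {m i : ℕ} (hi : 1 ≤ i) (him : i + 1 ≤ m) :
    Polynomial.aeval (TaftDouble.rCheckAt (TaftDouble.simpleModule hn2 hq hℓn r) hi him)
        (∏ U ∈ TaftDouble.squareSummands hn2 hq hℓn r,
          (Polynomial.X ^ 2 - Polynomial.C (TaftDouble.cScalar q ℓ r U))) = 0 ∧
      ∀ μ : k, Module.End.HasEigenvalue
          (TaftDouble.rCheckAt (TaftDouble.simpleModule hn2 hq hℓn r) hi him) μ →
        ∃ U ∈ TaftDouble.squareSummands hn2 hq hℓn r,
          ∃ t : k, t ^ 2 = TaftDouble.cScalar q ℓ r U ∧ (μ = t ∨ μ = -t) := by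
  have key : Polynomial.aeval (TaftDouble.rCheckAt (TaftDouble.simpleModule hn2 hq hℓn r) hi him)
      (∏ U ∈ TaftDouble.squareSummands hn2 hq hℓn r,
        (Polynomial.X ^ 2 - Polynomial.C (TaftDouble.cScalar q ℓ r U))) = 0 := by
    -- Evaluating a polynomial commutes with the algebra homomorphism that places an operator in two
    -- adjacent slots.
    rw [TaftDouble.rCheckAt, ← TaftDouble.atSlotsHom_apply, Polynomial.aeval_algHom_apply,
      TaftDouble.aeval_rCheck hn2 hq hℓn hℓ r hodd, map_zero]
  refine ⟨key, fun μ hμ => ?_⟩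
  have h0 := TaftDouble.eval_eq_zero_of_hasEigenvalue key hμ
  rw [Polynomial.eval_prod, Finset.prod_eq_zero_iff] at h0
  obtain ⟨U, hU, hμU⟩ := h0
  -- The eigenvalue itself serves as the square root of c_U.
  refine ⟨U, hU, μ, ?_, Or.inl rfl⟩
  simpa [sub_eq_zero] using hμU
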